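/- Let $p$ be a prime and let $\Lambda_p$ be the group of homeomorphisms of $\mathbb{Z}_p$ that act piecewise (with respect to a finite partition of $\mathbb{Z}_p$ into clopen sets) by maps of the form $x \mapsto ax+b$ with $a \in p^{\mathbb{Z}}$ and $b \in \mathbb{Z}[1/p]$. Let $\Lambda_p' = [\Lambda_p,\Lambda_p]$ be its derived subgroup, regarded as a discrete group. For $x \in \mathbb{Z}_p$ let $(\Lambda_p')_x^0$ denote the subgroup of those elements of $\Lambda_p'$ that act trivially on a neighbourhood of $x$. For a discrete group $G$, let $\mathrm{Sub}(G)$ be the space of subgroups of $G$ with the Chabauty topology. A uniformly recurrent subgroup (URS) of $G$ is a minimal non-empty closed conjugation-invariant subset of $\mathrm{Sub}(G)$; it is non-trivial if it is neither $\{\{1\}\}$ nor $\{G\}$. The stabilizer URS of a minimal action of $G$ on a compact space $X$ is the unique URS contained in the closure of $\{G_x : x \in X\}$ in $\mathrm{Sub}(G)$, where $G_x$ is the stabilizer of $x$. Then the action of $\Lambda_p'$ on $\mathbb{Z}_p$ is minimal, its stabilizer URS is exactly $\{(\Lambda_p')_x^0 : x \in \mathbb{Z}_p\}$, and this is a non-trivial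 URS of $\Lambda_p'$ and the only non-trivial one. -/

import Mathlib

open Topology

noncomputable section

/-! ## Uniformly recurrent subgroups of a discrete group -/

section URS

variable (G : Type*) [Group G] (X : Type*) [TopologicalSpace X] [MulAction G X]

/-- The Chabauty topology on the set `Sub(G)` of subgroups of a discrete group `G`.
For a discrete group every subgroup is closed, and "compact" and "relatively compact open" both
mean "finite", so the usual pre-basis of the Chabauty topology consists of the sets
`{H | H ∩ V ≠ ∅}` and `{H | H ∩ C = ∅}` for finite subsets `V` and `C` of `G`. -/
instance chabautyTopology : TopologicalSpace (Subgroup G) :=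
  TopologicalSpace.generateFrom
    ({U | ∃ V : Set G, V.Finite ∧ U = {H : Subgroup G | ((H : Set G) ∩ V).Nonempty}} ∪
     {U | ∃ C : Set G, C.Finite ∧ U = {H : Subgroup G | (H : Set G) ∩ C = ∅}})

variable {G}

/-- A set of subgroups is invariant if it is stable under conjugation by every `g : G`. -/
def ConjInvariant (S : Set (Subgroup G)) : Prop :=
  ∀ g : G, ∀ H ∈ S, H.map (MulAut.conj g).toMonoidHom ∈ S

/-- A uniformly recurrent subgroup (URS) of the discrete group `G`: a minimal element among the
non-empty closed conjugation-invariant subsets of `Sub(G)`. -/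
def IsURS (S : Set (Subgroup G)) : Prop :=
  Minimal (fun T : Set (Subgroup G) => T.Nonempty ∧ IsClosed T ∧ ConjInvariant T) S

/-- A URS is non-trivial if it is neither `{{1}}` nor `{G}`. -/
def IsNontrivialURS (S : Set (Subgroup G)) : Prop :=
  IsURS S ∧ S ≠ {⊥} ∧ S ≠ {⊤}

variable (G)

/-- `S` is the stabilizer URS of the (minimal) action of `G` on the compact space `X`: the unique
URS contained in the closure of the set of point stabilizers. -/
def IsStabilizerURS (S : Set (Subgroup G)) : Prop :=
  (IsURS S ∧ S ⊆ closure (Set.range fun x : X => MulAction.stabilizer G x)) ∧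
  ∀ T : Set (Subgroup G),
    IsURS T → T ⊆ closure (Set.range fun x : X => MulAction.stabilizer G x) → T = S

variable {X}

/-- The germ stabilizer `G_x^0`: the elements of `G` acting trivially on a neighbourhood of `x`. -/
def germStabilizer (x : X) : Subgroup G where
  carrier := {g | ∀ᶠ y in 𝓝 x, g • y = y}
  one_mem' := Filter.Eventually.of_forall fun y => one_smul G y
  mul_mem' := by
    intro g h hg hh
    filter_upwards [hg, hh] with y h1 h2
    rw [mul_smul, h2, h1]
  inv_mem' := by
    intro g hg
    filter_upwards [hg] with y hy
    rw [inv_smul_eq_iff, hy]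

end URS

/-! ## The group `Λ_p` -/

/-- The tautological action of the homeomorphism group of `X` on `X`. -/
instance homeoMulAction (X : Type*) [TopologicalSpace X] : MulAction (X ≃ₜ X) X where
  smul g x := g x
  one_smul _ := rfl
  mul_smul _ _ _ := rfl

section Lambda

variable (p : ℕ) [Fact p.Prime]

/-- The ring `ℤ[1/p]`, as a subring of `ℚ_p`. -/
def zInv : Subring ℚ_[p] := Subring.closure {(p : ℚ_[p])⁻¹}

variable {p} in
theorem zpow_mem_zInv (k : ℤ) : (p : ℚ_[p]) ^ k ∈ zInv p := by
  cases k with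
  | ofNat n =>
    rw [Int.ofNat_eq_natCast, zpow_natCast]
    exact pow_mem (natCast_mem _ p) n
  | negSucc n =>
    rw [zpow_negSucc, ← inv_pow]
    exact pow_mem (Subring.subset_closure (Set.mem_singleton ((p : ℚ_[p])⁻¹))) _

/-- A self-map `f` of `ℤ_p` acts piecewise by maps `x ↦ a x + b` with `a ∈ p^ℤ`, `b ∈ ℤ[1/p]`.
The coefficients `a = p ^ k x` and `b = b x` are locally constant functions of the point `x`; since
`ℤ_p` is compact, their common level sets form a finite partition of `ℤ_p` into clopen pieces, on
each of which `f` is the restriction of a single map `x ↦ a x + b`. -/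
def IsPiecewiseAffine (f : ℤ_[p] → ℤ_[p]) : Prop :=
  ∃ (k : ℤ_[p] → ℤ) (b : ℤ_[p] → ℚ_[p]),
    IsLocallyConstant k ∧ IsLocallyConstant b ∧
    ∀ x, b x ∈ zInv p ∧ (f x : ℚ_[p]) = (p : ℚ_[p]) ^ k x * (x : ℚ_[p]) + b x

/-- The group `Λ_p` of piecewise affine homeomorphisms of `ℤ_p`, with slopes in `p^ℤ` and
translation parts in `ℤ[1/p]`. -/
def Lambda : Subgroup (ℤ_[p] ≃ₜ ℤ_[p]) where
  carrier := {g | IsPiecewiseAffine p g}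
  one_mem' := ⟨fun _ => 0, fun _ => 0, IsLocallyConstant.const 0, IsLocallyConstant.const 0,
    fun x => ⟨zero_mem _, by simp⟩⟩
  mul_mem' := by
    rintro g h ⟨k, b, hk, hb, hg⟩ ⟨l, c, hl, hc, hh⟩
    have hp : (p : ℚ_[p]) ≠ 0 := Nat.cast_ne_zero.2 (Fact.out : p.Prime).ne_zero
    have hk' : IsLocallyConstant fun x => k (h x) := hk.comp_continuous h.continuous
    have hb' : IsLocallyConstant fun x => b (h x) := hb.comp_continuous h.continuous
    refine ⟨fun x => k (h x) + l x, fun x => (p : ℚ_[p]) ^ k (h x) * c x + b (h x),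
      hk'.comp₂ hl (· + ·),
      (hk'.comp₂ hc fun m z => (p : ℚ_[p]) ^ m * z).comp₂ hb' (· + ·), fun x => ⟨?_, ?_⟩⟩
    · exact add_mem (mul_mem (zpow_mem_zInv _) (hh x).1) (hg _).1
    · rw [Homeomorph.mul_apply, (hg _).2, (hh x).2, zpow_add₀ hp]
      ring
  inv_mem' := by
    rintro g ⟨k, b, hk, hb, hg⟩
    have hp : (p : ℚ_[p]) ≠ 0 := Nat.cast_ne_zero.2 (Fact.out : p.Prime).ne_zero
    have hk' : IsLocallyConstant fun x => k (g.symm x) := hk.comp_continuous g.symm.continuous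
    have hb' : IsLocallyConstant fun x => b (g.symm x) := hb.comp_continuous g.symm.continuous
    refine ⟨fun x => -k (g.symm x), fun x => -((p : ℚ_[p]) ^ (-k (g.symm x)) * b (g.symm x)),
      hk'.comp (fun m => -m), hk'.comp₂ hb' (fun m z => -((p : ℚ_[p]) ^ (-m) * z)),
      fun x => ⟨?_, ?_⟩⟩
    · exact neg_mem (mul_mem (zpow_mem_zInv _) (hg _).1)
    · have h := (hg (g.symm x)).2
      rw [g.apply_symm_apply] at h
      rw [Homeomorph.inv_apply, h, mul_add, ← mul_assoc, ← zpow_add₀ hp]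
      simp

/-- The derived subgroup `Λ_p' = [Λ_p, Λ_p]`, as a subgroup of the homeomorphism group of `ℤ_p`. -/
def LambdaDerived : Subgroup (ℤ_[p] ≃ₜ ℤ_[p]) := ⁅Lambda p, Lambda p⁆

end Lambda

end

/-! The argument rests on how flexible the derived subgroup is. Every ball of `ℤ_p` contains
arbitrarily many disjoint affine copies of `ℤ_p`. Since a 3-cycle is a commutator of transpositions,
three disjoint copies can be permuted cyclically by an element of `Λ_p'` (`exists_threeCycle`).
Consequently `Λ_p'` is generated by the germ stabilizers of any two distinct points
(`LambdaDerived_le_of_germs`), and a commutator argument with displaced supports makes it simple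
(`LambdaDerived_le_of_normal`). It is infinite, hence has no proper subgroup of finite index.

A non-trivial affine germ has at most an isolated fixed point. So if `x` tends to `z` with `x ≠ z`,
any subgroups squeezed between the germ stabilizer and the stabilizer of `x` converge to the germ
stabilizer of `z`. The germ stabilizers therefore form a URS, lying in the closure of the
stabilizers.

For uniqueness, let `S` be a URS other than `{⊥}`. As `⊥ ∉ S`, some finite set of non-trivial
elements meets every member of `S`. The members containing a given one of these elements are
compared on a family of displaced balls, which covers `Λ_p'` by finitely many cosets. Neumann's
lemma and simplicity then show that a member `H` of `S` contains a full copy of `Λ_p'` living on a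
small image (`exists_embedding_spreadDerived_mem`). Conjugates of `H` contain the fixators of ever
smaller sets around a point `y`, and a limit `L ∈ S` contains the germ stabilizer of `y`. If `L ≠
⊤`, then `L` fixes `y`; the squeezing argument and minimality finish the proof. -/

/-! ### Locally affine maps and small embeddings of `ℤ_p` -/

section LocallyAffine

variable {p : ℕ} [Fact p.Prime]

/-- The germ of `f` at `x` is that of a map `y ↦ p ^ k * y + b` with `b ∈ ℤ[1/p]`. -/
def LocallyAffineAt (f : ℤ_[p] → ℤ_[p]) (x : ℤ_[p]) : Prop :=
  ∃ (k : ℤ) (b : ℚ_[p]), b ∈ zInv p ∧ ∀ᶠ y in 𝓝 x, (f y : ℚ_[p]) = (p : ℚ_[p]) ^ k * y + b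

theorem padic_prime_ne_zero : (p : ℚ_[p]) ≠ 0 :=
  Nat.cast_ne_zero.2 (Fact.out : p.Prime).ne_zero

theorem padicInt_norm_p_lt_one : ‖(p : ℤ_[p])‖ < 1 := by
  rw [PadicInt.norm_p]
  exact inv_lt_one_of_one_lt₀ (by exact_mod_cast (Fact.out : p.Prime).one_lt)

theorem padic_zpow_injective {k l : ℤ} (h : (p : ℚ_[p]) ^ k = (p : ℚ_[p]) ^ l) : k = l := by
  have h' := congrArg Padic.valuation h
  simpa using h'

instance padicInt_neBot_nhdsNE (x : ℤ_[p]) : (𝓝[≠] x).NeBot := by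
  have ht : Filter.Tendsto (fun n : ℕ => x + (p : ℤ_[p]) ^ n) Filter.atTop (𝓝[≠] x) := by
    refine tendsto_nhdsWithin_iff.2 ⟨?_, Filter.Eventually.of_forall fun n => ?_⟩
    · have h0 : Filter.Tendsto (fun n : ℕ => (p : ℤ_[p]) ^ n) Filter.atTop (𝓝 0) :=
        tendsto_pow_atTop_nhds_zero_of_norm_lt_one padicInt_norm_p_lt_one
      simpa using tendsto_const_nhds.add h0
    · have : (p : ℤ_[p]) ≠ 0 := Nat.cast_ne_zero.2 (Fact.out : p.Prime).ne_zero
      simp [this]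
  exact ht.neBot

/-- Since `ℤ_p` has no isolated points, every neighbourhood of `x` contains a second point, and two
points determine an affine map. -/
theorem affine_germ_unique {k l : ℤ} {b c : ℚ_[p]} {x : ℤ_[p]}
    (h : ∀ᶠ y : ℤ_[p] in 𝓝 x, (p : ℚ_[p]) ^ k * y + b = (p : ℚ_[p]) ^ l * y + c) :
    k = l ∧ b = c := by
  obtain ⟨y, hy, hne⟩ := ((h.filter_mono nhdsWithin_le_nhds).and
    (self_mem_nhdsWithin : {x}ᶜ ∈ 𝓝[≠] x)).exists
  have hx := h.self_of_nhds
  have hne' : (y : ℚ_[p]) - x ≠ 0 := by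
    rw [sub_ne_zero]
    exact fun e => hne (Subtype.ext e)
  have e : (p : ℚ_[p]) ^ k = (p : ℚ_[p]) ^ l := by
    apply mul_right_cancel₀ hne'
    linear_combination hy - hx
  refine ⟨padic_zpow_injective e, ?_⟩
  rw [e] at hx
  exact add_left_cancel hx

/-- Coefficients chosen separately at each point are automatically locally constant, because an
affine germ determines them. Membership in `Λ_p` thus becomes a pointwise condition. -/
theorem isPiecewiseAffine_iff {f : ℤ_[p] → ℤ_[p]} :
    IsPiecewiseAffine p f ↔ ∀ x, LocallyAffineAt f x := by
  constructor
  · rintro ⟨k, b, hk, hb, h⟩ x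
    refine ⟨k x, b x, (h x).1, ?_⟩
    filter_upwards [hk.eventually_eq x, hb.eventually_eq x] with y h1 h2
    rw [← h1, ← h2, (h y).2]
  · intro h
    choose k b hb h using h
    have key : ∀ x, ∀ᶠ y in 𝓝 x, k y = k x ∧ b y = b x := by
      intro x
      filter_upwards [(h x).eventually_nhds] with y hy
      apply affine_germ_unique (x := y)
      filter_upwards [hy, h y] with z h1 h2
      rw [← h1, ← h2]
    refine ⟨k, b, ?_, ?_, fun x => ⟨hb x, (h x).self_of_nhds⟩⟩
    · exact (IsLocallyConstant.iff_eventually_eq k).2 fun x => (key x).mono fun y hy => hy.1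
    · exact (IsLocallyConstant.iff_eventually_eq b).2 fun x => (key x).mono fun y hy => hy.2

theorem mem_Lambda_iff {g : ℤ_[p] ≃ₜ ℤ_[p]} : g ∈ Lambda p ↔ ∀ x, LocallyAffineAt g x :=
  isPiecewiseAffine_iff

namespace LocallyAffineAt

variable {f g : ℤ_[p] → ℤ_[p]} {x : ℤ_[p]}

theorem congr (hf : LocallyAffineAt f x) (h : f =ᶠ[𝓝 x] g) : LocallyAffineAt g x := by
  obtain ⟨k, b, hb, hf⟩ := hf
  refine ⟨k, b, hb, ?_⟩
  filter_upwards [hf, h] with y h1 h2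
  rw [← h2, h1]

theorem id (x : ℤ_[p]) : LocallyAffineAt (fun y => y) x :=
  ⟨0, 0, zero_mem _, Filter.Eventually.of_forall fun y => by simp⟩

theorem map_nhds (hf : LocallyAffineAt f x) : Filter.map f (𝓝 x) = 𝓝 (f x) := by
  obtain ⟨k, b, -, hf⟩ := hf
  have hk : (p : ℚ_[p]) ^ k ≠ 0 := zpow_ne_zero _ padic_prime_ne_zero
  let A : ℚ_[p] ≃ₜ ℚ_[p] := (Homeomorph.mulLeft₀ _ hk).trans (Homeomorph.addRight b)
  have hA : ∀ y, A y = (p : ℚ_[p]) ^ k * y + b := fun y => rfl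
  have hE (y : ℤ_[p]) : Filter.map (fun x : ℤ_[p] => (x : ℚ_[p])) (𝓝 y) = 𝓝 (y : ℚ_[p]) :=
    PadicInt.isOpenEmbedding_coe.map_nhds_eq y
  have e : (fun x : ℤ_[p] => (x : ℚ_[p])) ∘ f =ᶠ[𝓝 x] A ∘ fun x : ℤ_[p] => (x : ℚ_[p]) := by
    filter_upwards [hf] with y hy
    simp [hA, hy]
  have hinj : Function.Injective fun x : ℤ_[p] => (x : ℚ_[p]) := fun _ _ h => Subtype.ext h
  apply Filter.map_injective hinj
  rw [hE, Filter.map_map, Filter.map_congr e, ← Filter.map_map, hE, A.map_nhds_eq, hA,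
    ← hf.self_of_nhds]

theorem continuousAt (hf : LocallyAffineAt f x) : ContinuousAt f x := hf.map_nhds.le

theorem comp (hg : LocallyAffineAt g (f x)) (hf : LocallyAffineAt f x) :
    LocallyAffineAt (fun y => g (f y)) x := by
  have hc := hf.continuousAt
  obtain ⟨k, b, hb, hf⟩ := hf
  obtain ⟨l, c, hc', hg⟩ := hg
  refine ⟨l + k, (p : ℚ_[p]) ^ l * b + c, add_mem (mul_mem (zpow_mem_zInv _) hb) hc', ?_⟩
  filter_upwards [hf, hc.eventually hg] with y h1 h2
  rw [h2, h1, zpow_add₀ padic_prime_ne_zero]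
  ring

/-- Lets local affinity be checked after pulling back along the chart `f`, which is open at `x`. -/
theorem of_comp (hg : LocallyAffineAt (fun y => g (f y)) x) (hf : LocallyAffineAt f x) :
    LocallyAffineAt g (f x) := by
  have hm := hf.map_nhds
  obtain ⟨k, b, hb, hf⟩ := hf
  obtain ⟨l, c, hc, hg⟩ := hg
  refine ⟨l - k, c - (p : ℚ_[p]) ^ (l - k) * b,
    sub_mem hc (mul_mem (zpow_mem_zInv _) hb), ?_⟩
  rw [← hm, Filter.eventually_map]
  filter_upwards [hf, hg] with y h1 h2
  have e : (p : ℚ_[p]) ^ l = (p : ℚ_[p]) ^ (l - k) * (p : ℚ_[p]) ^ k := by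
    rw [← zpow_add₀ padic_prime_ne_zero, sub_add_cancel]
  rw [h2, h1, e]
  ring

/-- An affine map of slope different from 1 has at most one fixed point; one of slope 1 with a fixed
point is the identity. -/
theorem eventually_eq_or_ne (hf : LocallyAffineAt f x) :
    (∀ᶠ y in 𝓝 x, f y = y) ∨ ∀ᶠ y in 𝓝[≠] x, f y ≠ y := by
  by_cases hx : f x = x
  · obtain ⟨k, b, -, hf⟩ := hf
    by_cases hk : (p : ℚ_[p]) ^ k = 1
    · left
      have h0 := hf.self_of_nhds
      rw [hx, hk, one_mul, left_eq_add] at h0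
      filter_upwards [hf] with y hy
      rw [hk, h0, one_mul, add_zero] at hy
      exact Subtype.ext hy
    · right
      have h0 := hf.self_of_nhds
      rw [hx] at h0
      filter_upwards [hf.filter_mono nhdsWithin_le_nhds, self_mem_nhdsWithin] with y hy hne e
      rw [e] at hy
      have : ((p : ℚ_[p]) ^ k - 1) * ((y : ℚ_[p]) - x) = 0 := by linear_combination h0 - hy
      rcases mul_eq_zero.1 this with h | h
      · exact hk (sub_eq_zero.1 h)
      · exact hne (Subtype.ext (sub_eq_zero.1 h))
  · right
    have := hf.continuousAt.tendsto.prodMk_nhds (Filter.tendsto_id (α := ℤ_[p]) (x := 𝓝 x))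
    refine Filter.Eventually.filter_mono nhdsWithin_le_nhds ?_
    exact this.eventually (isClosed_diagonal.isOpen_compl.mem_nhds hx)

end LocallyAffineAt

/-- The affine contraction of `ℤ_p` onto the ball of radius `p ^ (-n)` around `x`. -/
noncomputable def contraction (x : ℤ_[p]) (n : ℕ) (z : ℤ_[p]) : ℤ_[p] :=
  (p : ℤ_[p]) ^ n * z + (x.appr n : ℤ_[p])

theorem contraction_injective (x : ℤ_[p]) (n : ℕ) : Function.Injective (contraction x n) := by
  intro z w h
  have : (p : ℤ_[p]) ^ n ≠ 0 :=
    pow_ne_zero _ (Nat.cast_ne_zero.2 (Fact.out : p.Prime).ne_zero)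
  exact mul_left_cancel₀ this (add_right_cancel h)

/-- The translation part is the integer truncation of `x`, which is what puts it in `ℤ[1/p]`; `x`
itself need not lie there. -/
theorem contraction_locallyAffineAt (x : ℤ_[p]) (n : ℕ) (z : ℤ_[p]) :
    LocallyAffineAt (contraction x n) z :=
  ⟨n, x.appr n, natCast_mem _ _, Filter.Eventually.of_forall fun y => by simp [contraction]⟩

theorem mem_range_contraction (x : ℤ_[p]) (n : ℕ) : x ∈ Set.range (contraction x n) := by
  obtain ⟨z, hz⟩ := Ideal.mem_span_singleton.1 (PadicInt.appr_spec n x)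
  exact ⟨z, by rw [contraction, ← hz, sub_add_cancel]⟩

/-- Injective maps that are locally of the form `y ↦ p ^ k * y + b` with `b ∈ ℤ[1/p]`. -/
structure IsAffineEmbedding (f : ℤ_[p] → ℤ_[p]) : Prop where
  locallyAffineAt : ∀ x, LocallyAffineAt f x
  injective : Function.Injective f

theorem contraction_isAffineEmbedding (x : ℤ_[p]) (n : ℕ) : IsAffineEmbedding (contraction x n) :=
  ⟨contraction_locallyAffineAt x n, contraction_injective x n⟩

theorem IsAffineEmbedding.comp_left {f : ℤ_[p] → ℤ_[p]} (hf : IsAffineEmbedding f)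
    {g : ℤ_[p] ≃ₜ ℤ_[p]} (hg : g ∈ Lambda p) : IsAffineEmbedding fun z => g (f z) :=
  ⟨fun x => (mem_Lambda_iff.1 hg _).comp (hf.locallyAffineAt x), g.injective.comp hf.injective⟩

theorem isOpen_range_of_locallyAffine {f : ℤ_[p] → ℤ_[p]} (hf : ∀ x, LocallyAffineAt f x) :
    IsOpen (Set.range f) := by
  rw [isOpen_iff_mem_nhds]
  rintro _ ⟨x, rfl⟩
  rw [← (hf x).map_nhds]
  exact Filter.range_mem_map

theorem isClosed_range_of_locallyAffine {f : ℤ_[p] → ℤ_[p]} (hf : ∀ x, LocallyAffineAt f x) :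
    IsClosed (Set.range f) :=
  (isCompact_range (continuous_iff_continuousAt.2 fun x => (hf x).continuousAt)).isClosed

theorem contraction_eventually_mem {x : ℤ_[p]} {U : Set ℤ_[p]} (hU : U ∈ 𝓝 x) :
    ∀ᶠ n in Filter.atTop, ∀ z, contraction x n z ∈ U := by
  obtain ⟨ε, hε, hU⟩ := Metric.mem_nhds_iff.1 hU
  have h0 : Filter.Tendsto (fun n : ℕ => ‖(p : ℤ_[p])‖ ^ n) Filter.atTop (𝓝 0) :=
    tendsto_pow_atTop_nhds_zero_of_lt_one (norm_nonneg _) padicInt_norm_p_lt_one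
  filter_upwards [h0.eventually (gt_mem_nhds hε)] with n hn z
  apply hU
  obtain ⟨w, hw⟩ := Ideal.mem_span_singleton.1 (PadicInt.appr_spec n x)
  rw [Metric.mem_ball, dist_eq_norm]
  have : contraction x n z - x = (p : ℤ_[p]) ^ n * (z - w) := by
    rw [contraction]
    linear_combination -hw
  rw [this, norm_mul, norm_pow]
  exact (mul_le_of_le_one_right (by positivity) (PadicInt.norm_le_one _)).trans_lt hn

theorem contraction_eventually_ne {f h : ℤ_[p] → ℤ_[p]} (hf : Continuous f) (hh : Continuous h)
    {x y : ℤ_[p]} (hne : f x ≠ h y) :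
    ∀ᶠ n in Filter.atTop, ∀ z w, f (contraction x n z) ≠ h (contraction y n w) := by
  obtain ⟨U, V, hU, hV, hx, hy, hd⟩ := t2_separation hne
  filter_upwards [contraction_eventually_mem (hf.continuousAt (hU.mem_nhds hx)),
    contraction_eventually_mem (hh.continuousAt (hV.mem_nhds hy))] with n h1 h2 z w e
  exact Set.disjoint_left.1 hd (h1 z) (e ▸ h2 w)

theorem exists_contraction_subset {U : Set ℤ_[p]} (hU : IsOpen U) {x : ℤ_[p]} (hx : x ∈ U) :
    ∃ n, ∀ z, contraction x n z ∈ U :=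
  (contraction_eventually_mem (hU.mem_nhds hx)).exists

theorem exists_disjoint_embeddings (k : ℕ) {U : Set ℤ_[p]} (hU : IsOpen U) (hne : U.Nonempty) :
    ∃ σ : Fin k → ℤ_[p] → ℤ_[p], (∀ i, IsAffineEmbedding (σ i)) ∧ (∀ i z, σ i z ∈ U) ∧
      ∀ i j, i ≠ j → ∀ z w, σ i z ≠ σ j w := by
  obtain ⟨x, hx⟩ := hne
  have hinf : U.Infinite := infinite_of_mem_nhds x (hU.mem_nhds hx)
  have := hinf.to_subtype
  let e := Infinite.natEmbedding U
  have h1 : ∀ᶠ n in Filter.atTop, ∀ i : Fin k, ∀ z, contraction (e i : ℤ_[p]) n z ∈ U :=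
    Filter.eventually_all.2 fun i => contraction_eventually_mem (hU.mem_nhds (e i).2)
  have h2 : ∀ᶠ n in Filter.atTop, ∀ i j : Fin k, i ≠ j →
      ∀ z w, contraction (e i : ℤ_[p]) n z ≠ contraction (e j : ℤ_[p]) n w := by
    refine Filter.eventually_all.2 fun i => Filter.eventually_all.2 fun j => ?_
    by_cases hij : i = j
    · exact Filter.Eventually.of_forall fun n h => absurd hij h
    · have hne : (e i : ℤ_[p]) ≠ e j := fun h =>
        hij (Fin.ext (e.injective (Subtype.ext h)))
      exact (contraction_eventually_ne continuous_id continuous_id hne).mono fun n h _ => h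
  obtain ⟨n, h1, h2⟩ := (h1.and h2).exists
  exact ⟨fun i => contraction (e i) n, fun i => contraction_isAffineEmbedding _ _, h1, h2⟩

open Classical in
/-- The identity outside of `U`, and `σ` on `U`. -/
noncomputable def shrinkOn (U : Set ℤ_[p]) (σ : ℤ_[p] → ℤ_[p]) (x : ℤ_[p]) : ℤ_[p] :=
  if x ∈ U then σ x else x

theorem shrinkOn_of_mem {U : Set ℤ_[p]} {σ : ℤ_[p] → ℤ_[p]} {x : ℤ_[p]} (hx : x ∈ U) :
    shrinkOn U σ x = σ x := if_pos hx

theorem shrinkOn_of_notMem {U : Set ℤ_[p]} {σ : ℤ_[p] → ℤ_[p]} {x : ℤ_[p]} (hx : x ∉ U) :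
    shrinkOn U σ x = x := if_neg hx

theorem shrinkOn_isAffineEmbedding {U : Set ℤ_[p]} (hU : IsClopen U) {σ : ℤ_[p] → ℤ_[p]}
    (hσ : IsAffineEmbedding σ) (h : ∀ z, σ z ∈ U) : IsAffineEmbedding (shrinkOn U σ) := by
  refine ⟨fun x => ?_, fun x y e => ?_⟩
  · by_cases hx : x ∈ U
    · refine (hσ.locallyAffineAt x).congr ?_
      filter_upwards [hU.isOpen.mem_nhds hx] with y hy
      rw [shrinkOn_of_mem hy]
    · refine (LocallyAffineAt.id x).congr ?_
      filter_upwards [hU.compl.isOpen.mem_nhds hx] with y hy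
      rw [shrinkOn_of_notMem hy]
  · by_cases hx : x ∈ U <;> by_cases hy : y ∈ U
    · rw [shrinkOn_of_mem hx, shrinkOn_of_mem hy] at e
      exact hσ.injective e
    · rw [shrinkOn_of_mem hx, shrinkOn_of_notMem hy] at e
      exact absurd (e ▸ h x) hy
    · rw [shrinkOn_of_notMem hx, shrinkOn_of_mem hy] at e
      exact absurd (e ▸ h y) hx
    · rwa [shrinkOn_of_notMem hx, shrinkOn_of_notMem hy] at e

/-- A non-empty open set `U` contains a clopen set `B` together with finitely many disjoint
images of embeddings, the first of which extends to an embedding that is trivial outside `B`. -/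
theorem exists_clopen_embeddings (k : ℕ) {U : Set ℤ_[p]} (hU : IsOpen U) (hne : U.Nonempty) :
    ∃ (B : Set ℤ_[p]) (α : ℤ_[p] → ℤ_[p]) (σ : Fin k → ℤ_[p] → ℤ_[p]), IsClopen B ∧ B ⊆ U ∧
      IsAffineEmbedding α ∧ (∀ i, IsAffineEmbedding (σ i)) ∧ (∀ x ∉ B, α x = x) ∧
      (∀ x ∈ B, α x ∈ B) ∧ (∀ i z, σ i z ∈ B) ∧ (∀ i z w, α z ≠ σ i w) ∧
      ∀ i j, i ≠ j → ∀ z w, σ i z ≠ σ j w := by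
  obtain ⟨x, hx⟩ := hne
  obtain ⟨n, hn⟩ := exists_contraction_subset hU hx
  have hc := contraction_locallyAffineAt x n
  have hB : IsClopen (Set.range (contraction x n)) :=
    ⟨isClosed_range_of_locallyAffine hc, isOpen_range_of_locallyAffine hc⟩
  -- One embedding more than requested: `σ 0`, extended by the identity outside the ball, becomes
  -- `α`.
  obtain ⟨σ, hσ, hmem, hd⟩ :=
    exists_disjoint_embeddings (k + 1) hB.isOpen ⟨x, mem_range_contraction x n⟩
  refine ⟨Set.range (contraction x n), shrinkOn (Set.range (contraction x n)) (σ 0),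
    fun i => σ i.succ, hB, by rintro _ ⟨z, rfl⟩; exact hn z,
    shrinkOn_isAffineEmbedding hB (hσ 0) (hmem 0), fun i => hσ _, fun x => shrinkOn_of_notMem,
    fun x hx => shrinkOn_of_mem (σ := σ 0) hx ▸ hmem 0 x, fun i => hmem _, fun i z w => ?_,
    fun i j hij => hd _ _ (by simpa using hij)⟩
  by_cases hz : z ∈ Set.range (contraction x n)
  · rw [shrinkOn_of_mem hz]
    exact hd _ _ (Fin.succ_ne_zero i).symm z w
  · rw [shrinkOn_of_notMem hz]
    exact fun e => hz (e ▸ hmem _ w)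

end LocallyAffine

/-! ### Homeomorphisms permuting disjoint images, and 3-cycles -/

section Wreath

open scoped commutatorElement

variable {p : ℕ} [Fact p.Prime] {J : Type*}

variable (p J) in
/-- A family of locally affine self-embeddings of `ℤ_p` with pairwise disjoint images. -/
structure AffineFamily where
  /-- The underlying family of maps. -/
  toFun : J → ℤ_[p] → ℤ_[p]
  locallyAffineAt : ∀ j x, LocallyAffineAt (toFun j) x
  injective : Function.Injective fun q : J × ℤ_[p] => toFun q.1 q.2

namespace AffineFamily

instance : CoeFun (AffineFamily p J) fun _ => J → ℤ_[p] → ℤ_[p] := ⟨toFun⟩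

/-- A family of locally affine embeddings with disjoint images, as an `AffineFamily`. -/
def ofDisjoint (f : J → ℤ_[p] → ℤ_[p]) (hf : ∀ j, IsAffineEmbedding (f j))
    (hd : ∀ i j, i ≠ j → ∀ z w, f i z ≠ f j w) :
    AffineFamily p J where
  toFun := f
  locallyAffineAt := fun j => (hf j).locallyAffineAt
  injective := by
    rintro ⟨i, z⟩ ⟨j, w⟩ h
    by_cases hij : i = j
    · subst hij
      exact congrArg _ ((hf i).injective h)
    · exact absurd h (hd i j hij z w)

/-- A single embedding, as a one-element family. -/
def single {f : ℤ_[p] → ℤ_[p]} (hf : IsAffineEmbedding f) : AffineFamily p Unit :=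
  ofDisjoint (fun _ => f) (fun _ => hf) fun _ _ h => absurd rfl h

variable (τ : AffineFamily p J)

/-- The map acting on the images of the family by `τ j z ↦ τ (π j) (u z)`, and trivially
elsewhere. -/
noncomputable def wreathMap (π : Equiv.Perm J) (u : ℤ_[p] → ℤ_[p]) : ℤ_[p] → ℤ_[p] :=
  Function.extend (fun q : J × ℤ_[p] => τ q.1 q.2) (fun q => τ (π q.1) (u q.2)) id

theorem wreathMap_apply (π : Equiv.Perm J) (u : ℤ_[p] → ℤ_[p]) (j : J) (z : ℤ_[p]) :
    τ.wreathMap π u (τ j z) = τ (π j) (u z) :=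
  τ.injective.extend_apply (fun q => τ (π q.1) (u q.2)) id (j, z)

theorem wreathMap_of_notMem (π : Equiv.Perm J) (u : ℤ_[p] → ℤ_[p]) {y : ℤ_[p]}
    (hy : ∀ j z, τ j z ≠ y) : τ.wreathMap π u y = y :=
  Function.extend_apply' _ id y fun ⟨q, hq⟩ => hy q.1 q.2 hq

theorem wreathMap_comp (π ρ : Equiv.Perm J) (u v : ℤ_[p] → ℤ_[p]) (y : ℤ_[p]) :
    τ.wreathMap π u (τ.wreathMap ρ v y) = τ.wreathMap (π * ρ) (fun z => u (v z)) y := by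
  by_cases hy : ∀ j z, τ j z ≠ y
  · rw [τ.wreathMap_of_notMem ρ v hy, τ.wreathMap_of_notMem π u hy, τ.wreathMap_of_notMem _ _ hy]
  · push Not at hy
    obtain ⟨j, z, rfl⟩ := hy
    simp [wreathMap_apply]

theorem wreathMap_one (y : ℤ_[p]) : τ.wreathMap 1 (fun z => z) y = y := by
  by_cases hy : ∀ j z, τ j z ≠ y
  · rw [τ.wreathMap_of_notMem _ _ hy]
  · push Not at hy
    obtain ⟨j, z, rfl⟩ := hy
    simp [wreathMap_apply]

variable [Finite J]

theorem wreathMap_eventually_eq (π : Equiv.Perm J) (u : ℤ_[p] → ℤ_[p]) {y : ℤ_[p]}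
    (hy : ∀ j z, τ j z ≠ y) : ∀ᶠ x in 𝓝 y, τ.wreathMap π u x = x := by
  have hc : IsClosed (⋃ j, Set.range (τ j)) :=
    isClosed_iUnion_of_finite fun j => isClosed_range_of_locallyAffine (τ.locallyAffineAt j)
  have hm : y ∈ (⋃ j, Set.range (τ j))ᶜ := by
    simpa using hy
  filter_upwards [hc.isOpen_compl.mem_nhds hm] with x hx
  exact τ.wreathMap_of_notMem π u fun j z h => hx (Set.mem_iUnion.2 ⟨j, z, h⟩)

theorem continuous_wreathMap (π : Equiv.Perm J) {u : ℤ_[p] → ℤ_[p]} (hu : Continuous u) :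
    Continuous (τ.wreathMap π u) := by
  rw [continuous_iff_continuousAt]
  intro y
  by_cases hy : ∀ j z, τ j z ≠ y
  · exact continuousAt_id.congr
      ((τ.wreathMap_eventually_eq π u hy).mono fun x hx => hx.symm)
  · push Not at hy
    obtain ⟨j, z, rfl⟩ := hy
    rw [ContinuousAt, ← (τ.locallyAffineAt j z).map_nhds, Filter.tendsto_map'_iff, wreathMap_apply]
    have : τ.wreathMap π u ∘ τ j = fun z => τ (π j) (u z) :=
      funext fun z => τ.wreathMap_apply π u j z
    rw [this]
    exact (τ.locallyAffineAt (π j) (u z)).continuousAt.comp (f := u) hu.continuousAt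

theorem locallyAffineAt_wreathMap (π : Equiv.Perm J) {u : ℤ_[p] → ℤ_[p]}
    (hu : ∀ x, LocallyAffineAt u x) (y : ℤ_[p]) : LocallyAffineAt (τ.wreathMap π u) y := by
  by_cases hy : ∀ j z, τ j z ≠ y
  · exact (LocallyAffineAt.id y).congr
      ((τ.wreathMap_eventually_eq π u hy).mono fun x hx => hx.symm)
  · push Not at hy
    obtain ⟨j, z, rfl⟩ := hy
    refine LocallyAffineAt.of_comp ?_ (τ.locallyAffineAt j z)
    simp only [wreathMap_apply]
    exact (τ.locallyAffineAt (π j) (u z)).comp (hu z)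

/-- The wreath product action on the images of an `AffineFamily`, extended by the identity. -/
noncomputable def wreathHom : Equiv.Perm J × (ℤ_[p] ≃ₜ ℤ_[p]) →* (ℤ_[p] ≃ₜ ℤ_[p]) where
  toFun q :=
    { toFun := τ.wreathMap q.1 q.2
      invFun := τ.wreathMap q.1⁻¹ q.2.symm
      left_inv := fun y => by simp [wreathMap_comp, wreathMap_one]
      right_inv := fun y => by simp [wreathMap_comp, wreathMap_one]
      continuous_toFun := τ.continuous_wreathMap _ q.2.continuous
      continuous_invFun := τ.continuous_wreathMap _ q.2.symm.continuous }
  map_one' := Homeomorph.ext fun y => τ.wreathMap_one y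
  map_mul' q r := Homeomorph.ext fun y => (τ.wreathMap_comp q.1 r.1 q.2 r.2 y).symm

theorem wreathHom_apply (q : Equiv.Perm J × (ℤ_[p] ≃ₜ ℤ_[p])) (j : J) (z : ℤ_[p]) :
    τ.wreathHom q (τ j z) = τ (q.1 j) (q.2 z) :=
  τ.wreathMap_apply _ _ j z

theorem wreathHom_of_notMem (q : Equiv.Perm J × (ℤ_[p] ≃ₜ ℤ_[p])) {y : ℤ_[p]}
    (hy : ∀ j z, τ j z ≠ y) : τ.wreathHom q y = y :=
  τ.wreathMap_of_notMem _ _ hy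

theorem wreathHom_mem_Lambda {q : Equiv.Perm J × (ℤ_[p] ≃ₜ ℤ_[p])} (hq : q.2 ∈ Lambda p) :
    τ.wreathHom q ∈ Lambda p :=
  mem_Lambda_iff.2 (τ.locallyAffineAt_wreathMap q.1 (mem_Lambda_iff.1 hq))

/-- The diagonal action on the images of an `AffineFamily`, extended by the identity. -/
noncomputable def spread : (ℤ_[p] ≃ₜ ℤ_[p]) →* (ℤ_[p] ≃ₜ ℤ_[p]) :=
  τ.wreathHom.comp (MonoidHom.inr _ _)

theorem spread_apply (u : ℤ_[p] ≃ₜ ℤ_[p]) (j : J) (z : ℤ_[p]) :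
    τ.spread u (τ j z) = τ j (u z) :=
  τ.wreathHom_apply (1, u) j z

theorem spread_of_notMem (u : ℤ_[p] ≃ₜ ℤ_[p]) {y : ℤ_[p]} (hy : ∀ j z, τ j z ≠ y) :
    τ.spread u y = y :=
  τ.wreathHom_of_notMem (1, u) hy

theorem spread_mem_Lambda {u : ℤ_[p] ≃ₜ ℤ_[p]} (hu : u ∈ Lambda p) : τ.spread u ∈ Lambda p :=
  τ.wreathHom_mem_Lambda (q := (1, u)) hu

theorem spread_mem_LambdaDerived {u : ℤ_[p] ≃ₜ ℤ_[p]} (hu : u ∈ LambdaDerived p) :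
    τ.spread u ∈ LambdaDerived p := by
  have hle : (Lambda p).map τ.spread ≤ Lambda p :=
    Subgroup.map_le_iff_le_comap.2 fun u hu => τ.spread_mem_Lambda hu
  have h : (LambdaDerived p).map τ.spread ≤ LambdaDerived p := by
    rw [LambdaDerived, Subgroup.map_commutator]
    exact Subgroup.commutator_mono hle hle
  exact h (Subgroup.mem_map_of_mem _ hu)

/-- Characterization of `spread` for a one-element family. -/
theorem spread_single_eq {f : ℤ_[p] → ℤ_[p]} (hf : IsAffineEmbedding f) {u g : ℤ_[p] ≃ₜ ℤ_[p]}
    (h : ∀ z, g (f z) = f (u z))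
    (h' : ∀ y, (∀ z, f z ≠ y) → g y = y) : (single hf).spread u = g := by
  refine Homeomorph.ext fun y => ?_
  by_cases hy : ∀ z, f z ≠ y
  · rw [h' y hy, spread_of_notMem]
    exact fun _ => hy
  · push Not at hy
    obtain ⟨z, rfl⟩ := hy
    rw [h]
    exact (single hf).spread_apply u () z

end AffineFamily

theorem LambdaDerived_le_Lambda : LambdaDerived p ≤ Lambda p := by
  rw [LambdaDerived, Subgroup.commutator_le]
  intro g hg h hh
  rw [commutatorElement_def]
  exact mul_mem (mul_mem (mul_mem hg hh) (inv_mem hg)) (inv_mem hh)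

/-- Three locally affine embeddings of `ℤ_p` with disjoint images are permuted cyclically by an
element of the derived subgroup supported on these images. -/
theorem exists_threeCycle {α β γ : ℤ_[p] → ℤ_[p]}
    (hα : IsAffineEmbedding α) (hβ : IsAffineEmbedding β) (hγ : IsAffineEmbedding γ)
    (hαβ : ∀ z w, α z ≠ β w) (hαγ : ∀ z w, α z ≠ γ w)
    (hβγ : ∀ z w, β z ≠ γ w) :
    ∃ g ∈ LambdaDerived p, (∀ z, g (α z) = β z) ∧
      ∀ y, (∀ z, α z ≠ y) → (∀ z, β z ≠ y) → (∀ z, γ z ≠ y) → g y = y := by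
  let τ : AffineFamily p (Fin 3) := AffineFamily.ofDisjoint ![α, β, γ]
    (by intro j; fin_cases j <;> assumption)
    (by
      intro i j hij z w
      fin_cases i <;> fin_cases j <;> simp at hij ⊢
      exacts [hαβ z w, hαγ z w, (hαβ w z).symm, hβγ z w, (hαγ w z).symm, (hβγ w z).symm])
  -- The commutator of these transpositions is a 3-cycle sending 0 to 1; this is why a third image
  -- is needed to move the first onto the second inside the derived subgroup.
  let a : Equiv.Perm (Fin 3) := Equiv.swap 0 1
  let b : Equiv.Perm (Fin 3) := Equiv.swap 0 2
  have hab : ⁅a, b⁆ 0 = 1 := by decide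
  have e : τ.wreathHom (⁅a, b⁆, 1) = ⁅τ.wreathHom (a, 1), τ.wreathHom (b, 1)⁆ := by
    rw [← map_commutatorElement]
    congr 1
  refine ⟨τ.wreathHom (⁅a, b⁆, 1), ?_, fun z => ?_, fun y h0 h1 h2 => ?_⟩
  · rw [e]
    exact Subgroup.commutator_mem_commutator
      (τ.wreathHom_mem_Lambda (q := (_, 1)) (one_mem _))
      (τ.wreathHom_mem_Lambda (q := (_, 1)) (one_mem _))
  · have := τ.wreathHom_apply (⁅a, b⁆, 1) 0 z
    rw [hab] at this
    exact this
  · apply τ.wreathHom_of_notMem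
    intro j z
    fin_cases j
    exacts [h0 z, h1 z, h2 z]

end Wreath

/-! ### Generation and simplicity of the derived subgroup -/

section DerivedSubgroup

open scoped commutatorElement

/-- Used with `b` and `d` copies of `a` and `c` on disjoint supports: the corrected entries are
themselves commutators, so they land in the subgroup of interest while the commutator is unchanged.
-/
theorem commutatorElement_mul_inv_mul_inv {G : Type*} [Group G] {a b c d : G}
    (h : Commute b (c * d⁻¹)) (h' : Commute d a) : ⁅a * b⁻¹, c * d⁻¹⁆ = ⁅a, c⁆ := by
  have h1 : b⁻¹ * (c * d⁻¹) * b = c * d⁻¹ := by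
    rw [mul_assoc, ← h.eq, inv_mul_cancel_left]
  have h2 : d⁻¹ * a⁻¹ * d = a⁻¹ := by
    rw [mul_assoc, ← h'.inv_right.eq, inv_mul_cancel_left]
  calc ⁅a * b⁻¹, c * d⁻¹⁆ = a * (b⁻¹ * (c * d⁻¹) * b) * a⁻¹ * (d * c⁻¹) := by
        rw [commutatorElement_def]; group
    _ = a * c * (d⁻¹ * a⁻¹ * d) * c⁻¹ := by rw [h1]; group
    _ = ⁅a, c⁆ := by rw [h2, commutatorElement_def]

theorem homeomorph_commute {X : Type*} [TopologicalSpace X] {g h : X ≃ₜ X}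
    (hd : ∀ x, g x = x ∨ h x = x) : Commute g h := by
  refine Homeomorph.ext fun x => ?_
  change g (h x) = h (g x)
  rcases hd x with hg | hh
  · rcases hd (h x) with hg' | hh'
    · rw [hg', hg]
    · rw [h.injective hh', hg, h.injective hh']
  · rcases hd (g x) with hg' | hh'
    · rw [hh, g.injective hg', hh]
    · rw [hh, hh']

theorem homeomorph_inv_apply_eq {X : Type*} [TopologicalSpace X] {g : X ≃ₜ X} {x y : X}
    (h : g x = y) : g⁻¹ y = x := by
  rw [Homeomorph.inv_apply, ← h, g.symm_apply_apply]

variable {p : ℕ} [Fact p.Prime]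

open AffineFamily

theorem single_spread_apply {f : ℤ_[p] → ℤ_[p]} (hf : IsAffineEmbedding f) (u : ℤ_[p] ≃ₜ ℤ_[p])
    (z : ℤ_[p]) : (single hf).spread u (f z) = f (u z) :=
  (single hf).spread_apply u () z

theorem single_spread_of_notMem {f : ℤ_[p] → ℤ_[p]} (hf : IsAffineEmbedding f)
    (u : ℤ_[p] ≃ₜ ℤ_[p]) {y : ℤ_[p]} (hy : ∀ z, f z ≠ y) : (single hf).spread u y = y :=
  (single hf).spread_of_notMem u fun _ => hy

theorem conj_single_spread {f h : ℤ_[p] → ℤ_[p]} (hf : IsAffineEmbedding f)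
    (hh : IsAffineEmbedding h) {w : ℤ_[p] ≃ₜ ℤ_[p]} (hw : ∀ z, w (f z) = h z)
    (u : ℤ_[p] ≃ₜ ℤ_[p]) : (single hh).spread u = w * (single hf).spread u * w⁻¹ := by
  refine spread_single_eq hh (fun z => ?_) fun y hy => ?_
  · change w ((single hf).spread u (w⁻¹ (h z))) = _
    rw [homeomorph_inv_apply_eq (hw z), single_spread_apply, hw]
  · change w ((single hf).spread u (w⁻¹ y)) = _
    rw [single_spread_of_notMem, Homeomorph.inv_apply, w.apply_symm_apply]
    intro z hz
    apply hy z
    rw [← hw, hz, Homeomorph.inv_apply, w.apply_symm_apply]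

/-- Conjugating by an element that agrees with an embedding `f` outside of `B` transports
homeomorphisms that are trivial on `B`. -/
theorem conj_eq_single_spread {f : ℤ_[p] → ℤ_[p]} (hf : IsAffineEmbedding f)
    {η u : ℤ_[p] ≃ₜ ℤ_[p]} {B : Set ℤ_[p]} (hη : ∀ z ∉ B, η z = f z) (hu : ∀ z ∈ B, u z = z) :
    (single hf).spread u = η * u * η⁻¹ := by
  have hη' : ∀ x, η (η⁻¹ x) = x := fun x => by
    rw [Homeomorph.inv_apply, η.apply_symm_apply]
  refine spread_single_eq hf (fun z => ?_) fun y hy => ?_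
  · change η (u (η⁻¹ (f z))) = _
    by_cases hz : z ∈ B
    · have : η⁻¹ (f z) ∈ B := by
        by_contra hn
        have h1 := hη _ hn
        rw [hη'] at h1
        exact hn (hf.injective h1 ▸ hz)
      rw [hu _ this, hu z hz, hη']
    · have hz' : u z ∉ B := fun h => hz (by rwa [u.injective (hu _ h)] at h)
      rw [homeomorph_inv_apply_eq (hη z hz), hη _ hz']
  · change η (u (η⁻¹ y)) = _
    have : η⁻¹ y ∈ B := by
      by_contra hn
      exact hy _ (by rw [← hη _ hn, hη'])
    rw [hu _ this, hη']

/-- Let `α` be the identity off a clopen set where `g` is trivial. Then `g` is its own copy along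
`α`, so it suffices to treat copies of commutators of `Λ_p`. The copies of `a` and `b` need not lie
in `Λ_p'`. Dividing each by a further copy, on its own disjoint image, brings it there without
changing the commutator. -/
theorem mem_of_forall_commutator_mem {N : Subgroup (ℤ_[p] ≃ₜ ℤ_[p])}
    (hN : ∀ B : Set ℤ_[p], IsOpen B → B.Nonempty → ∀ f ∈ LambdaDerived p, ∀ h ∈ LambdaDerived p,
      (∀ y ∈ B, f y = y) → (∀ y ∈ B, h y = y) → ⁅f, h⁆ ∈ N)
    {g : ℤ_[p] ≃ₜ ℤ_[p]} (hg : g ∈ LambdaDerived p) {x : ℤ_[p]} (hx : ∀ᶠ y in 𝓝 x, g y = y) :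
    g ∈ N := by
  obtain ⟨U, hUg, hU, hxU⟩ := eventually_nhds_iff.1 hx
  -- Of the four extra images, 0 and 1 carry the correcting copies, 2 completes both 3-cycles, and 3
  -- is the open set left fixed.
  obtain ⟨B, α, σ, -, hBU, hα, hσ, hαB, hαB', -, hασ, hσσ⟩ :=
    exists_clopen_embeddings 4 hU ⟨x, hxU⟩
  obtain ⟨v, hv, hv', hvs⟩ := exists_threeCycle hα (hσ 0) (hσ 2) (hασ 0) (hασ 2)
    (hσσ 0 2 (by decide))
  obtain ⟨w, hw, hw', hws⟩ := exists_threeCycle hα (hσ 1) (hσ 2) (hασ 1) (hασ 2)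
    (hσσ 1 2 (by decide))
  let Φ := (single hα).spread
  have hmem : ∀ u ∈ Lambda p, ∀ s ∈ LambdaDerived p, Φ u * (s * Φ u * s⁻¹)⁻¹ ∈ LambdaDerived p := by
    intro u hu s hs
    rw [show Φ u * (s * Φ u * s⁻¹)⁻¹ = ⁅Φ u, s⁆ by rw [commutatorElement_def]; group]
    exact Subgroup.commutator_mem_commutator ((single hα).spread_mem_Lambda hu)
      (LambdaDerived_le_Lambda hs)
  have hfix : ∀ u i z, i ≠ 3 → (single (hσ i)).spread u (σ 3 z) = σ 3 z := fun u i z hi =>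
    single_spread_of_notMem _ _ fun w => hσσ i 3 hi w z
  have hfixα : ∀ u i z, Φ u (σ i z) = σ i z := fun u i z =>
    single_spread_of_notMem _ _ fun w => hασ i w z
  have hcomα : ∀ i a b, Commute ((single (hσ i)).spread a) (Φ b) := by
    intro i a b
    refine homeomorph_commute fun y => ?_
    by_cases hy : ∀ z, σ i z ≠ y
    · exact Or.inl (single_spread_of_notMem _ _ hy)
    · push Not at hy
      obtain ⟨z, rfl⟩ := hy
      exact Or.inr (hfixα _ _ _)
  have hcomσ : ∀ a b, Commute ((single (hσ 0)).spread a) ((single (hσ 1)).spread b) := by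
    intro a b
    refine homeomorph_commute fun y => ?_
    by_cases hy : ∀ z, σ 0 z ≠ y
    · exact Or.inl (single_spread_of_notMem _ _ hy)
    · push Not at hy
      obtain ⟨z, rfl⟩ := hy
      exact Or.inr (single_spread_of_notMem _ _ fun w => hσσ 1 0 (by decide) w z)
  have hle : LambdaDerived p ≤ N.comap Φ := by
    rw [LambdaDerived, Subgroup.commutator_le]
    intro a ha b hb
    rw [Subgroup.mem_comap, map_commutatorElement,
      ← commutatorElement_mul_inv_mul_inv (b := (single (hσ 0)).spread a)
        (d := (single (hσ 1)).spread b) ((hcomα 0 a b).mul_right (hcomσ a b).inv_right)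
        (hcomα 1 b a)]
    refine hN (Set.range (σ 3)) (isOpen_range_of_locallyAffine (hσ 3).locallyAffineAt)
      (Set.range_nonempty _) _ ?_ _ ?_ ?_ ?_
    · rw [conj_single_spread hα (hσ 0) hv']
      exact hmem a ha v hv
    · rw [conj_single_spread hα (hσ 1) hw']
      exact hmem b hb w hw
    · rintro _ ⟨z, rfl⟩
      rw [← map_inv]
      exact (congrArg (Φ a) (hfix _ 0 z (by decide))).trans (hfixα _ _ _)
    · rintro _ ⟨z, rfl⟩
      rw [← map_inv]
      exact (congrArg (Φ b) (hfix _ 1 z (by decide))).trans (hfixα _ _ _)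
  have hgα : Φ g = g := by
    have hgB : ∀ y ∈ B, g y = y := fun y hy => hUg y (hBU hy)
    refine spread_single_eq hα (fun z => ?_) fun y hy => hgB y ?_
    · by_cases hz : z ∈ B
      · rw [hgB z hz, hgB _ (hαB' z hz)]
      · have : g z ∉ B := fun h => hz (by rwa [g.injective (hgB _ h)] at h)
        rw [hαB z hz, hαB _ this]
    · by_contra hn
      exact hy y (hαB y hn)
  rw [← hgα]
  exact hle hg

theorem isClosed_range_of_isAffineEmbedding {f : ℤ_[p] → ℤ_[p]} (hf : IsAffineEmbedding f) :
    IsClosed (Set.range f) :=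
  isClosed_range_of_locallyAffine hf.locallyAffineAt

/-- A small ball at `x` is moved to its `g`-image by two 3-cycles through an auxiliary ball. The
detour is needed because the ball and its image may overlap. -/
theorem exists_LambdaDerived_germ_eq {g : ℤ_[p] ≃ₜ ℤ_[p]} (hg : g ∈ Lambda p) {x y : ℤ_[p]}
    (hxy : x ≠ y) (hgxy : g x ≠ y) :
    ∃ k ∈ LambdaDerived p, (∀ᶠ z in 𝓝 y, k z = z) ∧ ∀ᶠ z in 𝓝 x, k z = g z := by
  have hfin : ({x, g x, y} : Set ℤ_[p]).Finite := by simp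
  obtain ⟨ρ, hρ, hρU, hρd⟩ := exists_disjoint_embeddings 2 hfin.isClosed.isOpen_compl
    (hfin.infinite_compl).nonempty
  have hav : ∀ i, ∀ w ∈ ({x, g x, y} : Set ℤ_[p]), w ∈ (Set.range (ρ i))ᶜ := by
    rintro i _ hw ⟨z, rfl⟩
    exact hρU i z hw
  have hO : ∀ i, IsOpen (Set.range (ρ i))ᶜ := fun i =>
    (isClosed_range_of_isAffineEmbedding (hρ i)).isOpen_compl
  have hne : ∀ᶠ z in 𝓝 x, z ≠ y ∧ g z ≠ y ∧
      ∀ i, z ∈ (Set.range (ρ i))ᶜ ∧ g z ∈ (Set.range (ρ i))ᶜ := by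
    refine (isOpen_ne.eventually_mem hxy).and ((g.continuous.continuousAt.eventually
      (isOpen_ne.eventually_mem hgxy)).and (Filter.eventually_all.2 fun i => ?_))
    exact ((hO i).eventually_mem (hav i x (by simp))).and (g.continuous.continuousAt.eventually
      ((hO i).mem_nhds (hav i (g x) (by simp))))
  obtain ⟨n, hn⟩ := (contraction_eventually_mem hne).exists
  have hσ := contraction_isAffineEmbedding x n
  set σ := contraction x n with hσdef
  have hgσ := hσ.comp_left hg
  obtain ⟨k, hk, hkσ, hks⟩ := exists_threeCycle hσ (hρ 0) (hρ 1)
    (fun z w e => ((hn z).2.2 0).1 ⟨w, e.symm⟩) (fun z w e => ((hn z).2.2 1).1 ⟨w, e.symm⟩)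
    (hρd 0 1 (by decide))
  obtain ⟨l, hl, hlρ, hls⟩ := exists_threeCycle (hρ 0) hgσ (hρ 1)
    (fun z w e => ((hn w).2.2 0).2 ⟨z, e⟩) (hρd 0 1 (by decide))
    (fun z w e => ((hn z).2.2 1).2 ⟨w, e.symm⟩)
  refine ⟨l * k, mul_mem hl hk, ?_, ?_⟩
  · filter_upwards [(isClosed_range_of_isAffineEmbedding hσ).isOpen_compl.mem_nhds
      (show y ∈ (Set.range σ)ᶜ by rintro ⟨z, hz⟩; exact (hn z).1 hz),
      (isClosed_range_of_isAffineEmbedding hgσ).isOpen_compl.mem_nhds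
      (show y ∈ (Set.range fun z => g (σ z))ᶜ by rintro ⟨z, hz⟩; exact (hn z).2.1 hz),
      (hO 0).mem_nhds (hav 0 y (by simp)), (hO 1).mem_nhds (hav 1 y (by simp))] with z h1 h2 h3 h4
    have e1 : k z = z := hks z (fun w e => h1 ⟨w, e⟩) (fun w e => h3 ⟨w, e⟩) fun w e => h4 ⟨w, e⟩
    have e2 : l z = z := hls z (fun w e => h3 ⟨w, e⟩) (fun w e => h2 ⟨w, e⟩) fun w e => h4 ⟨w, e⟩
    rw [Homeomorph.mul_apply, e1, e2]
  · filter_upwards [(isOpen_range_of_locallyAffine hσ.locallyAffineAt).mem_nhds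
      (mem_range_contraction x n)]
    rintro _ ⟨z, rfl⟩
    rw [Homeomorph.mul_apply, hkσ, hlρ]

/-- A 3-cycle takes a ball around `x` inside `V` to one of two disjoint images inside `U` minus `x`.
-/
theorem exists_LambdaDerived_move (x : ℤ_[p]) {U V : Set ℤ_[p]} (hU : IsOpen U)
    (hne : U.Nonempty) (hV : V ∈ 𝓝 x) :
    ∃ g ∈ LambdaDerived p, g x ∈ U ∧ g x ≠ x ∧ ∀ y ∉ U, y ∉ V → g y = y := by
  have hne' : (U \ {x}).Nonempty := by
    obtain ⟨y, hy⟩ := hne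
    exact ((infinite_of_mem_nhds y (hU.mem_nhds hy)).sdiff (Set.finite_singleton x)).nonempty
  obtain ⟨ρ, hρ, hρU, hρd⟩ := exists_disjoint_embeddings 2 (hU.sdiff isClosed_singleton) hne'
  have hO : ∀ i, ∀ᶠ z in 𝓝 x, z ∈ (Set.range (ρ i))ᶜ := fun i =>
    (isClosed_range_of_isAffineEmbedding (hρ i)).isOpen_compl.mem_nhds (by
      rintro ⟨z, hz⟩
      exact (hρU i z).2 hz)
  obtain ⟨n, hn⟩ := (contraction_eventually_mem
    (Filter.inter_mem hV (Filter.eventually_all.2 hO))).exists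
  obtain ⟨g, hg, hgσ, hgs⟩ := exists_threeCycle (contraction_isAffineEmbedding x n) (hρ 0) (hρ 1)
    (fun z w e => (hn z).2 0 ⟨w, e.symm⟩) (fun z w e => (hn z).2 1 ⟨w, e.symm⟩)
    (hρd 0 1 (by decide))
  obtain ⟨z, hz⟩ := mem_range_contraction x n
  have hgx : g x = ρ 0 z := by rw [← hgσ, hz]
  refine ⟨g, hg, hgx ▸ (hρU 0 z).1, hgx ▸ (hρU 0 z).2, fun y hyU hyV => hgs y ?_ ?_ ?_⟩
  · rintro w rfl
    exact hyV (hn w).1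
  · rintro w rfl
    exact hyU (hρU 0 w).1
  · rintro w rfl
    exact hyU (hρU 1 w).1

/-- If `g x ≠ y`, choose `k` trivial near `y` with the germ of `g` at `x`; then `g = k * (k⁻¹ * g)`
and the second factor is trivial near `x`. If `g x = y`, first multiply by an element that is
trivial near `x` and moves `y`. -/
theorem LambdaDerived_le_of_germs {N : Subgroup (ℤ_[p] ≃ₜ ℤ_[p])} {x y : ℤ_[p]} (hxy : x ≠ y)
    (hx : ∀ g ∈ LambdaDerived p, (∀ᶠ z in 𝓝 x, g z = z) → g ∈ N)
    (hy : ∀ g ∈ LambdaDerived p, (∀ᶠ z in 𝓝 y, g z = z) → g ∈ N) : LambdaDerived p ≤ N := by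
  have key : ∀ g ∈ LambdaDerived p, g x ≠ y → g ∈ N := by
    intro g hg hgxy
    obtain ⟨k, hk, hky, hkx⟩ := exists_LambdaDerived_germ_eq (LambdaDerived_le_Lambda hg) hxy hgxy
    have h1 : k⁻¹ * g ∈ N := by
      refine hx _ (mul_mem (inv_mem hk) hg) ?_
      filter_upwards [hkx] with z hz
      exact homeomorph_inv_apply_eq hz
    have := mul_mem (hy k hk hky) h1
    rwa [mul_inv_cancel_left] at this
  intro g hg
  by_cases hgxy : g x = y
  · obtain ⟨V, W, hV, hW, hxV, hyW, hd⟩ := t2_separation hxy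
    obtain ⟨k, hk, -, hky, hks⟩ :=
      exists_LambdaDerived_move y hW ⟨y, hyW⟩ (hW.mem_nhds hyW)
    have hkx : k ∈ N := by
      refine hx k hk ?_
      filter_upwards [hV.mem_nhds hxV] with z hz
      exact hks z (Set.disjoint_left.1 hd hz) (Set.disjoint_left.1 hd hz)
    have h1 : k * g ∈ N := key _ (mul_mem hk hg) (by
      rw [Homeomorph.mul_apply, hgxy]
      exact hky)
    simpa using mul_mem (inv_mem hkx) h1
  · exact key g hg hgxy

/-- The set `U` provides the room: `α` is the identity off `U`, its image is moved into `U` by one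
3-cycle, and from there onto the image of `τ` by another. -/
theorem exists_LambdaDerived_eq_off {τ : ℤ_[p] → ℤ_[p]} (hτ : IsAffineEmbedding τ)
    {U : Set ℤ_[p]} (hU : IsOpen U) (hne : U.Nonempty) (hτU : ∀ z, τ z ∉ U) :
    ∃ η ∈ LambdaDerived p, ∀ z ∉ U, η z = τ z := by
  obtain ⟨B, α, σ, -, hBU, hα, hσ, hαB, -, hσB, hασ, hσσ⟩ := exists_clopen_embeddings 2 hU hne
  obtain ⟨v, hv, hv', -⟩ := exists_threeCycle hα (hσ 0) (hσ 1) (hασ 0) (hασ 1)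
    (hσσ 0 1 (by decide))
  obtain ⟨w, hw, hw', -⟩ := exists_threeCycle (hσ 0) hτ (hσ 1)
    (fun a b e => hτU b (e ▸ hBU (hσB 0 a))) (hσσ 0 1 (by decide))
    (fun a b e => hτU a (e ▸ hBU (hσB 1 b)))
  refine ⟨w * v, mul_mem hw hv, fun z hz => ?_⟩
  have := hv' z
  rw [hαB z fun h => hz (hBU h)] at this
  rw [Homeomorph.mul_apply, this, hw']

/-- Simplicity of the derived subgroup. -/
theorem LambdaDerived_le_of_normal {N : Subgroup (ℤ_[p] ≃ₜ ℤ_[p])}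
    (hnorm : ∀ g ∈ LambdaDerived p, ∀ n ∈ N, g * n * g⁻¹ ∈ N) {b : ℤ_[p] ≃ₜ ℤ_[p]} (hb : b ∈ N)
    (hb1 : b ≠ 1) : LambdaDerived p ≤ N := by
  obtain ⟨x, hx⟩ : ∃ x, b x ≠ x := by
    by_contra! h
    exact hb1 (Homeomorph.ext h)
  obtain ⟨V, W, hV, hW, hbxV, hxW, hVW⟩ := t2_separation hx
  let A := W ∩ b ⁻¹' V
  have hA : IsOpen A := hW.inter (hV.preimage b.continuous)
  have hbA : ∀ y ∈ A, b y ∉ A := fun y hy h => Set.disjoint_left.1 hVW hy.2 h.1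
  have key : ∀ B : Set ℤ_[p], IsOpen B → B.Nonempty → ∀ f ∈ LambdaDerived p,
      ∀ h ∈ LambdaDerived p, (∀ y ∈ B, f y = y) → (∀ y ∈ B, h y = y) → ⁅f, h⁆ ∈ N := by
    rintro B hB ⟨c, hc⟩ f hf h hh hfB hhB
    obtain ⟨a, haA, hac⟩ : (A \ {c}).Nonempty :=
      ((infinite_of_mem_nhds x (hA.mem_nhds ⟨hxW, hbxV⟩)).sdiff (Set.finite_singleton c)).nonempty
    obtain ⟨P, Q, hP, hQ, haP, hcQ, hPQ⟩ := t2_separation hac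
    -- Since `f` and `h` are both trivial on an open set, one element `η` of the derived subgroup
    -- conjugates them to homeomorphisms supported in `A`, which `b` displaces.
    obtain ⟨n, hn⟩ := exists_contraction_subset (hA.inter hP) ⟨haA, haP⟩
    have hτ := contraction_isAffineEmbedding a n
    obtain ⟨η, hη, hητ⟩ := exists_LambdaDerived_eq_off hτ (hB.inter hQ) ⟨c, hc, hcQ⟩
      fun z hz => Set.disjoint_left.1 hPQ (hn z).2 hz.2
    have hsupp : ∀ u : ℤ_[p] ≃ₜ ℤ_[p], ∀ y ∉ A, (single hτ).spread u y = y := fun u y hy =>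
      single_spread_of_notMem hτ u fun z e => hy (e ▸ (hn z).1)
    have ef := conj_eq_single_spread hτ hητ (u := f) fun z hz => hfB z hz.1
    have eh := conj_eq_single_spread hτ hητ (u := h) fun z hz => hhB z hz.1
    set f' := (single hτ).spread f with hf'
    set h' := (single hτ).spread h with hh'
    have hf'G : f' ∈ LambdaDerived p := (single hτ).spread_mem_LambdaDerived hf
    have hh'G : h' ∈ LambdaDerived p := (single hτ).spread_mem_LambdaDerived hh
    have hd : Commute (b * f' * b⁻¹) h' := by
      refine homeomorph_commute fun y => ?_
      by_cases hy : y ∈ A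
      · left
        change b (f' (b⁻¹ y)) = y
        have : b⁻¹ y ∉ A := fun hA' => hbA _ hA' (by
          rwa [Homeomorph.inv_apply, b.apply_symm_apply])
        rw [hsupp f _ this, Homeomorph.inv_apply, b.apply_symm_apply]
      · exact Or.inr (hsupp h y hy)
    -- This element is the commutator of `f'` and `b`. Because `b * f' * b⁻¹` commutes with `h'`,
    -- its commutator with `h'` is just that of `f'` and `h'`.
    have h1 : f' * (b * f' * b⁻¹)⁻¹ ∈ N := by
      rw [show f' * (b * f' * b⁻¹)⁻¹ = f' * b * f'⁻¹ * b⁻¹ by group]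
      exact mul_mem (hnorm f' hf'G b hb) (inv_mem hb)
    have h2 : ⁅f', h'⁆ ∈ N := by
      have e := commutatorElement_mul_inv_mul_inv (a := f') (b := b * f' * b⁻¹) (c := h') (d := 1)
        (by rwa [inv_one, mul_one]) (Commute.one_left _)
      rw [inv_one, mul_one] at e
      rw [← e, commutatorElement_def, mul_assoc, mul_assoc, ← mul_assoc h']
      exact mul_mem h1 (hnorm h' hh'G _ (inv_mem h1))
    have h3 := hnorm _ (inv_mem hη) _ h2
    rw [ef, eh] at h3
    convert h3 using 1
    simp only [commutatorElement_def]
    group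
  have h0 : ∀ z : ℤ_[p], ∀ g ∈ LambdaDerived p, (∀ᶠ y in 𝓝 z, g y = y) → g ∈ N :=
    fun z g hg hz => mem_of_forall_commutator_mem key hg hz
  exact LambdaDerived_le_of_germs (zero_ne_one (α := ℤ_[p])) (h0 0) (h0 1)

theorem LambdaDerived_infinite : Infinite (LambdaDerived p) := by
  by_contra hfin
  rw [not_infinite_iff_finite] at hfin
  have hr : (Set.range fun g : LambdaDerived p => (g : ℤ_[p] ≃ₜ ℤ_[p]) 0).Finite :=
    Set.finite_range _
  obtain ⟨g, hg, hgU, -⟩ := exists_LambdaDerived_move (0 : ℤ_[p]) hr.isClosed.isOpen_compl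
    hr.infinite_compl.nonempty Filter.univ_mem
  exact hgU ⟨⟨g, hg⟩, rfl⟩

end DerivedSubgroup

/-! ### Convergence of subgroups and minimality of a URS -/

section Chabauty

variable {G : Type*} [Group G]

theorem tendsto_chabauty {ι : Type*} {l : Filter ι} {K : ι → Subgroup G} {L : Subgroup G}
    (h : ∀ g, ∀ᶠ i in l, (g ∈ K i ↔ g ∈ L)) : Filter.Tendsto K l (𝓝 L) := by
  refine TopologicalSpace.tendsto_nhds_generateFrom_iff.2 ?_
  rintro _ (⟨V, -, rfl⟩ | ⟨C, hC, rfl⟩) hL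
  · obtain ⟨g, hgL, hgV⟩ := hL
    filter_upwards [h g] with i hi
    exact ⟨g, hi.2 hgL, hgV⟩
  · filter_upwards [(Filter.eventually_all_finite hC).2 fun g _ => h g] with i hi
    refine Set.eq_empty_iff_forall_notMem.2 fun g hg => ?_
    exact Set.eq_empty_iff_forall_notMem.1 hL g ⟨(hi g hg.2).1 hg.1, hg.2⟩

theorem isOpen_setOf_mem_subgroup (g : G) : IsOpen {H : Subgroup G | g ∈ H} := by
  refine TopologicalSpace.isOpen_generateFrom_of_mem (Or.inl ⟨{g}, Set.finite_singleton g, ?_⟩)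
  ext H
  simp

theorem isOpen_setOf_notMem_subgroup (g : G) : IsOpen {H : Subgroup G | g ∉ H} := by
  refine TopologicalSpace.isOpen_generateFrom_of_mem (Or.inr ⟨{g}, Set.finite_singleton g, ?_⟩)
  ext H
  simp

theorem eventually_mem_iff_chabauty (L : Subgroup G) (g : G) : ∀ᶠ K in 𝓝 L, (g ∈ K ↔ g ∈ L) := by
  by_cases hg : g ∈ L
  · filter_upwards [(isOpen_setOf_mem_subgroup g).mem_nhds hg] with K hK
    exact iff_of_true hK hg
  · filter_upwards [(isOpen_setOf_notMem_subgroup g).mem_nhds hg] with K hK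
    exact iff_of_false hK hg

/-- The Chabauty topology of a discrete group is that of pointwise convergence of indicator
functions. -/
theorem mem_closure_chabauty_iff {S : Set (Subgroup G)} {L : Subgroup G} :
    L ∈ closure S ↔ ∀ F : Finset G, ∃ K ∈ S, ∀ g ∈ F, (g ∈ K ↔ g ∈ L) := by
  constructor
  · intro h F
    obtain ⟨K, hK, hKS⟩ := mem_closure_iff_nhds.1 h _
      ((Filter.eventually_all_finset F).2 fun g _ => eventually_mem_iff_chabauty L g)
    exact ⟨K, hKS, hK⟩
  · intro h
    choose K hKS hK using h
    refine mem_closure_of_tendsto (tendsto_chabauty (l := Filter.atTop) (K := K) fun g => ?_)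
      (Filter.Eventually.of_forall hKS)
    filter_upwards [Filter.eventually_ge_atTop {g}] with F hF
    exact hK F g (hF (Finset.mem_singleton_self g))

theorem isClosed_singleton_subgroup (L : Subgroup G) : IsClosed ({L} : Set (Subgroup G)) := by
  refine isClosed_of_closure_subset fun K hK => ?_
  rw [mem_closure_chabauty_iff] at hK
  ext g
  obtain ⟨_, rfl, h⟩ := hK {g}
  exact (h g (Finset.mem_singleton_self g)).symm

/-- Sequential compactness of the space of subgroups, in the form of an ultralimit. -/
theorem exists_mem_of_eventually_mem {S : Set (Subgroup G)} (hS : IsClosed S)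
    {K : ℕ → Subgroup G} (hK : ∀ n, K n ∈ S) :
    ∃ L ∈ S, ∀ g, (∀ᶠ n in Filter.atTop, g ∈ K n) → g ∈ L := by
  let L : Subgroup G :=
    { carrier := {g | ∀ᶠ n in (Filter.hyperfilter ℕ : Filter ℕ), g ∈ K n}
      one_mem' := Filter.Eventually.of_forall fun n => one_mem _
      mul_mem' := fun ha hb => (ha.and hb).mono fun n h => mul_mem h.1 h.2
      inv_mem' := fun ha => Filter.Eventually.mono ha fun n h => inv_mem h }
  refine ⟨L, hS.mem_of_tendsto (b := (Filter.hyperfilter ℕ : Filter ℕ))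
    (tendsto_chabauty fun g => ?_)
    (Filter.Eventually.of_forall hK),
    fun g hg => hg.filter_mono Nat.hyperfilter_le_atTop⟩
  by_cases hg : g ∈ L
  · exact Filter.Eventually.mono hg fun n h => iff_of_true h hg
  · exact (Ultrafilter.eventually_not.2 hg).mono fun n h => iff_of_false h hg

theorem mem_map_conj_iff {g h : G} {H : Subgroup G} :
    h ∈ H.map (MulAut.conj g).toMonoidHom ↔ g⁻¹ * h * g ∈ H := by
  rw [Subgroup.mem_map_equiv, MulAut.conj_symm_apply]

theorem IsURS.eq_of_subset {S T : Set (Subgroup G)} (hS : IsURS S) (hT : T.Nonempty)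
    (hTc : IsClosed T) (hTi : ConjInvariant T) (h : T ⊆ S) : S = T :=
  (hS.2 ⟨hT, hTc, hTi⟩ h).antisymm h

theorem IsURS.eq_singleton {S : Set (Subgroup G)} (hS : IsURS S) {N : Subgroup G} (hN : N ∈ S)
    (hconj : ∀ g : G, N.map (MulAut.conj g).toMonoidHom = N) : S = {N} := by
  refine hS.eq_of_subset (Set.singleton_nonempty N) (isClosed_singleton_subgroup N) ?_
    (Set.singleton_subset_iff.2 hN)
  rintro g _ rfl
  exact hconj g

theorem IsURS.eq_singleton_bot {S : Set (Subgroup G)} (hS : IsURS S) (h : ⊥ ∈ S) : S = {⊥} :=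
  hS.eq_singleton h fun _ => Subgroup.map_bot _

theorem IsURS.eq_singleton_top {S : Set (Subgroup G)} (hS : IsURS S) (h : ⊤ ∈ S) : S = {⊤} :=
  hS.eq_singleton h fun g => Subgroup.map_top_of_surjective _ (MulAut.conj g).surjective

end Chabauty

/-! ### The URS of germ stabilizers -/

section GermStabilizers

variable {p : ℕ} [Fact p.Prime]

theorem mem_germStabilizer_iff {g : LambdaDerived p} {x : ℤ_[p]} :
    g ∈ germStabilizer (LambdaDerived p) x ↔ ∀ᶠ y in 𝓝 x, g • y = y := Iff.rfl

theorem continuous_LambdaDerived_smul (g : LambdaDerived p) :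
    Continuous fun x : ℤ_[p] => g • x := (g : ℤ_[p] ≃ₜ ℤ_[p]).continuous

theorem exists_smul_mem (x : ℤ_[p]) {U : Set ℤ_[p]} (hU : IsOpen U) (hne : U.Nonempty) :
    ∃ g : LambdaDerived p, g • x ∈ U := by
  obtain ⟨g, hg, hgU, -⟩ := exists_LambdaDerived_move x hU hne Filter.univ_mem
  exact ⟨⟨g, hg⟩, hgU⟩

theorem LambdaDerived_isMinimal : MulAction.IsMinimal (LambdaDerived p) ℤ_[p] := by
  refine ⟨fun x => dense_iff_inter_open.2 fun U hU hne => ?_⟩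
  obtain ⟨g, hg⟩ := exists_smul_mem x hU hne
  exact ⟨g • x, hg, g, rfl⟩

theorem eventually_smul_ne {g : LambdaDerived p} {x : ℤ_[p]}
    (h : g ∉ germStabilizer (LambdaDerived p) x) : ∀ᶠ y in 𝓝[≠] x, g • y ≠ y :=
  (mem_Lambda_iff.1 (LambdaDerived_le_Lambda g.2) x).eventually_eq_or_ne.resolve_left h

theorem germStabilizer_le_stabilizer (x : ℤ_[p]) :
    germStabilizer (LambdaDerived p) x ≤ MulAction.stabilizer (LambdaDerived p) x :=
  fun _ hg => (mem_germStabilizer_iff.1 hg).self_of_nhds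

theorem map_conj_germStabilizer (g : LambdaDerived p) (x : ℤ_[p]) :
    (germStabilizer (LambdaDerived p) x).map (MulAut.conj g).toMonoidHom =
      germStabilizer (LambdaDerived p) (g • x) := by
  have key : ∀ (g h : LambdaDerived p) (x : ℤ_[p]),
      h ∈ germStabilizer (LambdaDerived p) (g • x) →
        g⁻¹ * h * g ∈ germStabilizer (LambdaDerived p) x := by
    intro g h x hh
    have hc : ContinuousAt (fun x : ℤ_[p] => g • x) x :=
      (continuous_LambdaDerived_smul g).continuousAt
    rw [mem_germStabilizer_iff] at hh ⊢
    filter_upwards [hc.eventually hh] with y hy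
    rw [mul_smul, mul_smul, hy, inv_smul_smul]
  ext h
  rw [mem_map_conj_iff]
  refine ⟨fun hh => ?_, key g h x⟩
  have := key g⁻¹ (g⁻¹ * h * g) (g • x) (by rwa [inv_smul_smul])
  rwa [show g⁻¹⁻¹ * (g⁻¹ * h * g) * g⁻¹ = h by group] at this

/-- If `g` is trivial near `z`, it is trivial near every nearby `x`; otherwise it moves every nearby
`x ≠ z`. Uniformity in `K` gives convergence for stabilizers and germ stabilizers at once. -/
theorem eventually_mem_iff_germStabilizer (g : LambdaDerived p) (z : ℤ_[p]) :
    ∀ᶠ x in 𝓝[≠] z, ∀ K : Subgroup (LambdaDerived p), germStabilizer (LambdaDerived p) x ≤ K →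
      K ≤ MulAction.stabilizer (LambdaDerived p) x →
        (g ∈ K ↔ g ∈ germStabilizer (LambdaDerived p) z) := by
  by_cases hg : g ∈ germStabilizer (LambdaDerived p) z
  · filter_upwards [(mem_germStabilizer_iff.1 hg).eventually_nhds.filter_mono
      nhdsWithin_le_nhds] with x hx K hK _
    exact iff_of_true (hK hx) hg
  · filter_upwards [eventually_smul_ne hg] with x hx K _ hK
    exact iff_of_false (fun h => hx (hK h)) hg

theorem germStabilizer_mem_closure {T : Set (Subgroup (LambdaDerived p))} {z : ℤ_[p]}
    (h : ∃ᶠ x in 𝓝[≠] z, ∃ K ∈ T, germStabilizer (LambdaDerived p) x ≤ K ∧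
      K ≤ MulAction.stabilizer (LambdaDerived p) x) :
    germStabilizer (LambdaDerived p) z ∈ closure T := by
  rw [mem_closure_chabauty_iff]
  intro F
  obtain ⟨x, ⟨K, hKT, h1, h2⟩, hx⟩ := (h.and_eventually
    ((Filter.eventually_all_finset F).2 fun g _ => eventually_mem_iff_germStabilizer g z)).exists
  exact ⟨K, hKT, fun g hg => hx g hg K h1 h2⟩

theorem germStabilizer_mem_of_le {T : Set (Subgroup (LambdaDerived p))} (hT : IsClosed T)
    (hTi : ConjInvariant T) {K : Subgroup (LambdaDerived p)} (hK : K ∈ T) {x : ℤ_[p]}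
    (h1 : germStabilizer (LambdaDerived p) x ≤ K)
    (h2 : K ≤ MulAction.stabilizer (LambdaDerived p) x) (z : ℤ_[p]) :
    germStabilizer (LambdaDerived p) z ∈ T := by
  rw [← hT.closure_eq]
  refine germStabilizer_mem_closure (Filter.frequently_iff.2 fun {U} hU => ?_)
  obtain ⟨O, hO, hzO, hOU⟩ := mem_nhdsWithin.1 hU
  have hne : (O ∩ {z}ᶜ).Nonempty :=
    ((infinite_of_mem_nhds z (hO.mem_nhds hzO)).sdiff (Set.finite_singleton z)).nonempty
  obtain ⟨g, hg⟩ := exists_smul_mem x (hO.inter isClosed_singleton.isOpen_compl) hne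
  refine ⟨g • x, hOU hg, K.map (MulAut.conj g).toMonoidHom, hTi g K hK, ?_, ?_⟩
  · rw [← map_conj_germStabilizer]
    exact Subgroup.map_mono h1
  · intro h hh
    have := h2 (mem_map_conj_iff.1 hh)
    rw [MulAction.mem_stabilizer_iff, mul_smul, mul_smul, inv_smul_eq_iff] at this
    exact this

/-- Isolation of fixed points makes the set of `x` at which `g` has trivial germ clopen. A subgroup
in the closure therefore imposes closed conditions on `x` with the finite intersection property, and
compactness solves them all. -/
theorem isClosed_range_germStabilizer :
    IsClosed (Set.range fun x : ℤ_[p] => germStabilizer (LambdaDerived p) x) := by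
  refine isClosed_of_closure_subset fun K hK => ?_
  rw [mem_closure_chabauty_iff] at hK
  have hcl : ∀ g : LambdaDerived p,
      IsClosed {x : ℤ_[p] | g ∈ germStabilizer (LambdaDerived p) x ↔ g ∈ K} := by
    intro g
    have ho : IsOpen {x : ℤ_[p] | g ∈ germStabilizer (LambdaDerived p) x} :=
      isOpen_setOfPred_eventually_nhds
    by_cases hg : g ∈ K
    · simp only [hg, iff_true]
      rw [← isOpen_compl_iff, isOpen_iff_eventually]
      intro x hx
      have h := eventually_smul_ne hx
      rw [eventually_nhdsWithin_iff, ← eventually_eventually_nhds] at h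
      filter_upwards [h] with y hy hgy
      by_cases hyx : y = x
      · exact hx (hyx ▸ hgy)
      · exact hy.self_of_nhds hyx (germStabilizer_le_stabilizer y hgy)
    · simp only [hg, iff_false]
      exact ho.isClosed_compl
  obtain ⟨x, hx⟩ := CompactSpace.iInter_nonempty hcl fun F => by
    obtain ⟨_, ⟨x, rfl⟩, h⟩ := hK F
    exact ⟨x, Set.mem_iInter₂.2 h⟩
  exact ⟨x, Subgroup.ext fun g => Set.mem_iInter.1 hx g⟩

theorem conjInvariant_range_germStabilizer :
    ConjInvariant (Set.range fun x : ℤ_[p] => germStabilizer (LambdaDerived p) x) := by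
  rintro g _ ⟨x, rfl⟩
  exact ⟨g • x, (map_conj_germStabilizer g x).symm⟩

theorem isURS_range_germStabilizer :
    IsURS (Set.range fun x : ℤ_[p] => germStabilizer (LambdaDerived p) x) := by
  refine ⟨⟨Set.range_nonempty _, isClosed_range_germStabilizer,
    conjInvariant_range_germStabilizer⟩, ?_⟩
  rintro T ⟨⟨K, hK⟩, hTc, hTi⟩ hTR
  obtain ⟨x, rfl⟩ := hTR hK
  rintro _ ⟨z, rfl⟩
  exact germStabilizer_mem_of_le hTc hTi hK le_rfl (germStabilizer_le_stabilizer x) z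

theorem range_germStabilizer_subset_closure :
    (Set.range fun x : ℤ_[p] => germStabilizer (LambdaDerived p) x) ⊆
      closure (Set.range fun x : ℤ_[p] => MulAction.stabilizer (LambdaDerived p) x) := by
  rintro _ ⟨z, rfl⟩
  exact germStabilizer_mem_closure (Filter.Eventually.frequently (Filter.Eventually.of_forall
    fun x => ⟨_, ⟨x, rfl⟩, germStabilizer_le_stabilizer x, le_rfl⟩))

/-- For two non-trivial elements with disjoint supports, every point is fixed by at least one of
them. -/
theorem bot_notMem_closure_stabilizers :
    ⊥ ∉ closure (Set.range fun x : ℤ_[p] => MulAction.stabilizer (LambdaDerived p) x) := by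
  intro h
  rw [mem_closure_chabauty_iff] at h
  obtain ⟨V, W, hV, hW, h0, h1, hd⟩ := t2_separation (zero_ne_one (α := ℤ_[p]))
  obtain ⟨f, hf, -, hf0, hfs⟩ := exists_LambdaDerived_move 0 hV ⟨0, h0⟩ (hV.mem_nhds h0)
  obtain ⟨g, hg, -, hg1, hgs⟩ := exists_LambdaDerived_move 1 hW ⟨1, h1⟩ (hW.mem_nhds h1)
  classical
  obtain ⟨_, ⟨x, rfl⟩, hx⟩ := h {⟨f, hf⟩, ⟨g, hg⟩}
  have hf' : (⟨f, hf⟩ : LambdaDerived p) ≠ 1 := fun e => hf0 (by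
    rw [show f = 1 from congrArg Subtype.val e]; rfl)
  have hg' : (⟨g, hg⟩ : LambdaDerived p) ≠ 1 := fun e => hg1 (by
    rw [show g = 1 from congrArg Subtype.val e]; rfl)
  by_cases hxV : x ∈ V
  · have hxW := Set.disjoint_left.1 hd hxV
    exact hg' (Subgroup.mem_bot.1 ((hx _ (by simp)).1 (hgs x hxW hxW)))
  · exact hf' (Subgroup.mem_bot.1 ((hx _ (by simp)).1 (hfs x hxV hxV)))

/-- By compactness, finitely many elements already have no common fixed point. -/
theorem top_notMem_closure_stabilizers :
    ⊤ ∉ closure (Set.range fun x : ℤ_[p] => MulAction.stabilizer (LambdaDerived p) x) := by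
  intro h
  rw [mem_closure_chabauty_iff] at h
  have hex : ∀ x : ℤ_[p], ∃ g : LambdaDerived p, g • x ≠ x := by
    intro x
    obtain ⟨g, hg, -, hgx, -⟩ := exists_LambdaDerived_move x isOpen_univ Set.univ_nonempty
      Filter.univ_mem
    exact ⟨⟨g, hg⟩, hgx⟩
  obtain ⟨F, hF⟩ := isCompact_univ.elim_finite_subcover
    (fun g : LambdaDerived p => {x : ℤ_[p] | g • x ≠ x})
    (fun g => isOpen_ne_fun (continuous_LambdaDerived_smul g) continuous_id)
    fun x _ => Set.mem_iUnion.2 (hex x)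
  obtain ⟨_, ⟨x, rfl⟩, hx⟩ := h F
  obtain ⟨g, hg, hgx⟩ := Set.mem_iUnion₂.1 (hF (Set.mem_univ x))
  exact hgx ((hx g hg).2 (Subgroup.mem_top g))

end GermStabilizers

/-! ### Uniqueness of the non-trivial URS -/

section Uniqueness

variable {p : ℕ} [Fact p.Prime]

theorem normal_LambdaDerived_eq_top (N : Subgroup (LambdaDerived p)) [hN : N.Normal]
    (hne : N ≠ ⊥) : N = ⊤ := by
  obtain ⟨b, hb, hb1⟩ := (Subgroup.bot_or_exists_ne_one N).resolve_left hne
  have hle := LambdaDerived_le_of_normal (N := N.map (LambdaDerived p).subtype)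
    (by
      rintro g hg _ ⟨n, hn, rfl⟩
      exact ⟨⟨g, hg⟩ * n * ⟨g, hg⟩⁻¹, hN.conj_mem n hn ⟨g, hg⟩, rfl⟩)
    (Subgroup.mem_map_of_mem _ hb) (fun e => hb1 (Subtype.ext e))
  refine (Subgroup.eq_top_iff' N).2 fun g => ?_
  obtain ⟨n, hn, e⟩ := hle g.2
  rwa [← Subtype.ext e]

theorem finiteIndex_LambdaDerived_eq_top (L : Subgroup (LambdaDerived p)) [L.FiniteIndex] :
    L = ⊤ := by
  have := LambdaDerived_infinite (p := p)
  have hne : L.normalCore ≠ ⊥ := fun h => by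
    have hfi : (⊥ : Subgroup (LambdaDerived p)).FiniteIndex := h ▸ inferInstance
    exact hfi.index_ne_zero (by rw [Subgroup.index_bot, Nat.card_eq_zero_of_infinite])
  exact top_le_iff.1 (normal_LambdaDerived_eq_top L.normalCore hne ▸ L.normalCore_le)

/-- The restriction of `spread` to the derived subgroup. -/
noncomputable def AffineFamily.spreadDerived {J : Type*} [Finite J] (τ : AffineFamily p J) :
    LambdaDerived p →* LambdaDerived p :=
  (τ.spread.comp (LambdaDerived p).subtype).codRestrict _ fun u => τ.spread_mem_LambdaDerived u.2

section

variable {J : Type*} [Finite J] (τ : AffineFamily p J)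

theorem AffineFamily.spreadDerived_smul (u : LambdaDerived p) (j : J) (z : ℤ_[p]) :
    τ.spreadDerived u • τ j z = τ j (u • z) :=
  τ.spread_apply u j z

theorem AffineFamily.spreadDerived_smul_of_notMem (u : LambdaDerived p) {y : ℤ_[p]}
    (hy : ∀ j z, τ j z ≠ y) : τ.spreadDerived u • y = y :=
  τ.spread_of_notMem u hy

end

/-- Points are added one at a time: `g a` moves all points of a non-empty open set, which is
infinite, while only finitely many positions are forbidden. -/
theorem exists_points {J : Type*} [Finite J] (g : J → LambdaDerived p) (hg : ∀ j, g j ≠ 1) :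
    ∃ x : J → ℤ_[p], Function.Injective x ∧ ∀ j k, g j • x k ≠ x j := by
  classical
  have := Fintype.ofFinite J
  have key : ∀ s : Finset J, ∃ x : J → ℤ_[p], (∀ j ∈ s, ∀ k ∈ s, j ≠ k → x j ≠ x k) ∧
      ∀ j ∈ s, ∀ k ∈ s, g j • x k ≠ x j := by
    intro s
    induction s using Finset.induction_on with
    | empty => exact ⟨fun _ => 0, by simp, by simp⟩
    | insert a s ha ih =>
      obtain ⟨x, hx, hgx⟩ := ih
      obtain ⟨w, hw⟩ : ∃ w : ℤ_[p], g a • w ≠ w := by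
        by_contra! h
        exact hg a (Subtype.ext (Homeomorph.ext h))
      have hO : IsOpen {v : ℤ_[p] | g a • v ≠ v} :=
        isOpen_ne_fun (continuous_LambdaDerived_smul _) continuous_id
      -- The forbidden values ensure, in turn, that the new point `v` differs from `x k`, that `g a
      -- • x k ≠ v`, and that `g k • v ≠ x k`.
      have hfin : (⋃ k ∈ s, ({x k, g a • x k, (g k)⁻¹ • x k} : Set ℤ_[p])).Finite :=
        s.finite_toSet.biUnion fun k _ => by simp
      obtain ⟨v, hv, hvs⟩ := ((infinite_of_mem_nhds w (hO.mem_nhds hw)).sdiff hfin).nonempty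
      simp only [Set.mem_iUnion, Set.mem_insert_iff, Set.mem_singleton_iff, not_exists,
        not_or] at hvs
      have hupd : ∀ k ∈ s, Function.update x a v k = x k := fun k hk =>
        Function.update_of_ne (ne_of_mem_of_not_mem hk ha) _ _
      refine ⟨Function.update x a v, ?_, ?_⟩ <;> simp only [Finset.forall_mem_insert,
        Function.update_self]
      · refine ⟨⟨fun h => absurd rfl h, fun k hk _ => ?_⟩, fun j hj => ⟨fun _ => ?_, ?_⟩⟩
        · rw [hupd k hk]
          exact (hvs k hk).1
        · rw [hupd j hj]
          exact (hvs j hj).1 ∘ Eq.symm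
        · intro k hk
          rw [hupd j hj, hupd k hk]
          exact hx j hj k hk
      · refine ⟨⟨hv, fun k hk => ?_⟩, fun j hj => ⟨?_, fun k hk => ?_⟩⟩
        · rw [hupd k hk]
          exact (hvs k hk).2.1 ∘ Eq.symm
        · rw [hupd j hj]
          exact fun e => (hvs j hj).2.2 (eq_inv_smul_iff.2 e)
        · rw [hupd j hj, hupd k hk]
          exact hgx j hj k hk
  obtain ⟨x, hx, hgx⟩ := key Finset.univ
  exact ⟨x, fun j k e => by_contra fun h => hx j (Finset.mem_univ j) k (Finset.mem_univ k) h e,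
    fun j k => hgx j (Finset.mem_univ j) k (Finset.mem_univ k)⟩

/-- The points of `exists_points` are thickened to balls small enough to keep the finitely many
inequalities; `B` is a ball at one further point. -/
theorem exists_displaced_family {J : Type*} [Finite J] (g : J → LambdaDerived p)
    (hg : ∀ j, g j ≠ 1) :
    ∃ (τ : AffineFamily p J) (B : Set ℤ_[p]), IsOpen B ∧ B.Nonempty ∧
      (∀ j k z w, g j • τ k z ≠ τ j w) ∧ (∀ k z, τ k z ∉ B) ∧ ∀ j k z, g j • τ k z ∉ B := by
  obtain ⟨x, hx, hgx⟩ := exists_points g hg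
  have hfin : (Set.range x ∪ Set.range fun q : J × J => g q.1 • x q.2).Finite :=
    (Set.finite_range _).union (Set.finite_range _)
  obtain ⟨y, hy⟩ := hfin.infinite_compl.nonempty
  have hc := fun j => continuous_LambdaDerived_smul (g j)
  have h1 : ∀ᶠ n in Filter.atTop, ∀ j k, j ≠ k →
      ∀ z w, contraction (x j) n z ≠ contraction (x k) n w := by
    refine Filter.eventually_all.2 fun j => Filter.eventually_all.2 fun k => ?_
    by_cases hjk : j = k
    · exact Filter.Eventually.of_forall fun n h => absurd hjk h
    · exact (contraction_eventually_ne continuous_id continuous_id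
        (hx.ne hjk)).mono fun n h _ => h
  have h2 : ∀ᶠ n in Filter.atTop, ∀ j k, ∀ z w,
      g j • contraction (x k) n z ≠ contraction (x j) n w :=
    Filter.eventually_all.2 fun j => Filter.eventually_all.2 fun k =>
      contraction_eventually_ne (hc j) continuous_id (hgx j k)
  have h3 : ∀ᶠ n in Filter.atTop, ∀ k, ∀ z w, contraction (x k) n z ≠ contraction y n w :=
    Filter.eventually_all.2 fun k => contraction_eventually_ne continuous_id continuous_id
      fun e => hy (Or.inl ⟨k, e⟩)
  have h4 : ∀ᶠ n in Filter.atTop, ∀ j k, ∀ z w,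
      g j • contraction (x k) n z ≠ contraction y n w :=
    Filter.eventually_all.2 fun j => Filter.eventually_all.2 fun k =>
      contraction_eventually_ne (hc j) continuous_id fun e => hy (Or.inr ⟨(j, k), e⟩)
  obtain ⟨n, h1, h2, h3, h4⟩ := (h1.and (h2.and (h3.and h4))).exists
  refine ⟨AffineFamily.ofDisjoint (fun j => contraction (x j) n)
    (fun j => contraction_isAffineEmbedding _ _) h1, Set.range (contraction y n),
    isOpen_range_of_locallyAffine (contraction_locallyAffineAt y n), Set.range_nonempty _, h2,
    fun k z => ?_, fun j k z => ?_⟩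
  · rintro ⟨w, e⟩
    exact h3 k z w e.symm
  · rintro ⟨w, e⟩
    exact h4 j k z w e.symm

open scoped Pointwise in
/-- If every conjugate of `K` contains one of finitely many elements `g j` displacing the images
of an affine family, then `K` induces the full derived subgroup on one of these images. -/
theorem exists_index_forall_exists_mem {J : Type*} [Finite J] {g : J → LambdaDerived p}
    {τ : AffineFamily p J} {B : Set ℤ_[p]} (hτ : ∀ j k z w, g j • τ k z ≠ τ j w)
    (hB : ∀ k z, τ k z ∉ B) (hgB : ∀ j k z, g j • τ k z ∉ B) (K : Subgroup (LambdaDerived p))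
    (hK : ∀ u : LambdaDerived p, ∃ j, u⁻¹ * g j * u ∈ K) :
    ∃ j, ∀ u : LambdaDerived p, ∃ a ∈ K, (∀ z, a • τ j z = τ j (u • z)) ∧ ∀ y ∈ B, a • y = y := by
  classical
  have := Fintype.ofFinite J
  let L (j : J) : Subgroup (LambdaDerived p) :=
    { carrier := {u | ∃ a ∈ K, (∀ z, a • τ j z = τ j (u • z)) ∧ ∀ y ∈ B, a • y = y}
      one_mem' := ⟨1, one_mem _, fun z => by simp, fun y _ => one_smul _ y⟩
      mul_mem' := by
        rintro u v ⟨a, ha, ha1, ha2⟩ ⟨b, hb, hb1, hb2⟩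
        exact ⟨a * b, mul_mem ha hb, fun z => by rw [mul_smul, hb1, ha1, mul_smul],
          fun y hy => by rw [mul_smul, hb2 y hy, ha2 y hy]⟩
      inv_mem' := by
        rintro u ⟨a, ha, ha1, ha2⟩
        exact ⟨a⁻¹, inv_mem ha, fun z => by rw [inv_smul_eq_iff, ha1, smul_inv_smul],
          fun y hy => by rw [inv_smul_eq_iff, ha2 y hy]⟩ }
  let Φ := τ.spreadDerived
  let Y (j : J) : Set (LambdaDerived p) := {u | (Φ u)⁻¹ * g j * Φ u ∈ K}
  -- The inverse of `g j` carries the image of `τ j` off all images, where `Φ` acts trivially. So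
  -- the quotient of the two conjugates of `g j` acts on that image as `u⁻¹ * v`, and `Y j` lies in
  -- one left coset of `L j`.
  have hY : ∀ j, ∀ u ∈ Y j, ∀ v ∈ Y j, u⁻¹ * v ∈ L j := by
    intro j u hu v hv
    refine ⟨(Φ u)⁻¹ * g j * Φ u * ((Φ v)⁻¹ * g j * Φ v)⁻¹, mul_mem hu (inv_mem hv), ?_, ?_⟩
    · intro z
      have hfix : ∀ w, Φ w • ((g j)⁻¹ • τ j (v • z)) = (g j)⁻¹ • τ j (v • z) := fun w =>
        τ.spreadDerived_smul_of_notMem w fun k t e => hτ j k t (v • z) (by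
          rw [e, smul_inv_smul])
      calc ((Φ u)⁻¹ * g j * Φ u * ((Φ v)⁻¹ * g j * Φ v)⁻¹) • τ j z
          = (Φ u)⁻¹ • g j • Φ u • (Φ v)⁻¹ • (g j)⁻¹ • Φ v • τ j z := by
            simp only [mul_smul, mul_inv_rev, inv_inv]
        _ = (Φ u)⁻¹ • τ j (v • z) := by
            rw [τ.spreadDerived_smul, ← map_inv Φ v, hfix, hfix, smul_inv_smul]
        _ = τ j ((u⁻¹ * v) • z) := by
            rw [← map_inv Φ u, τ.spreadDerived_smul, mul_smul]
    · intro y hy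
      have hfix : ∀ w, Φ w • y = y := fun w =>
        τ.spreadDerived_smul_of_notMem w fun k t e => hB k t (e ▸ hy)
      have hfix' : ∀ w, Φ w • ((g j)⁻¹ • y) = (g j)⁻¹ • y := fun w =>
        τ.spreadDerived_smul_of_notMem w fun k t e => hgB j k t (by rwa [e, smul_inv_smul])
      calc ((Φ u)⁻¹ * g j * Φ u * ((Φ v)⁻¹ * g j * Φ v)⁻¹) • y
          = (Φ u)⁻¹ • g j • Φ u • (Φ v)⁻¹ • (g j)⁻¹ • Φ v • y := by
            simp only [mul_smul, mul_inv_rev, inv_inv]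
        _ = y := by
            rw [hfix, ← map_inv Φ v, hfix', hfix', smul_inv_smul, ← map_inv Φ u, hfix]
  have hcover : ∀ u, ∃ j, u ∈ Y j := fun u => hK (Φ u)
  choose v hv using fun j : {j : J // (Y j).Nonempty} => j.2
  have hcov : ⋃ j ∈ (Finset.univ : Finset {j : J // (Y j).Nonempty}),
      v j • (L j : Set (LambdaDerived p)) = Set.univ := by
    refine Set.eq_univ_of_forall fun u => ?_
    obtain ⟨j, hj⟩ := hcover u
    refine Set.mem_iUnion₂.2 ⟨⟨j, u, hj⟩, Finset.mem_univ _, ?_⟩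
    rw [mem_leftCoset_iff]
    exact hY j _ (hv ⟨j, u, hj⟩) u hj
  -- Neumann's lemma: in a finite cover by cosets, one of the subgroups has finite index, and here
  -- it must be everything.
  obtain ⟨j, -, hj⟩ := Subgroup.exists_finiteIndex_of_leftCoset_cover hcov
  refine ⟨j, fun u => ?_⟩
  have : u ∈ L j := by
    rw [finiteIndex_LambdaDerived_eq_top (L j)]
    exact Subgroup.mem_top u
  exact this

theorem LambdaDerived_eq_top_of_germs {K : Subgroup (LambdaDerived p)} {x y : ℤ_[p]} (hxy : x ≠ y)
    (hx : germStabilizer (LambdaDerived p) x ≤ K) (hy : germStabilizer (LambdaDerived p) y ≤ K) :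
    K = ⊤ := by
  have hle := LambdaDerived_le_of_germs (N := K.map (LambdaDerived p).subtype) hxy
    (fun g hg h => ⟨⟨g, hg⟩, hx h, rfl⟩) (fun g hg h => ⟨⟨g, hg⟩, hy h, rfl⟩)
  refine (Subgroup.eq_top_iff' K).2 fun g => ?_
  obtain ⟨n, hn, e⟩ := hle g.2
  rwa [← Subtype.ext e]

/-- An element `k` of `K` moving `x` would conjugate the germ stabilizer of `x` to that of `k • x`,
and the two together generate the whole group. -/
theorem le_stabilizer_of_germStabilizer_le {K : Subgroup (LambdaDerived p)} (hK : K ≠ ⊤)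
    {x : ℤ_[p]} (hx : germStabilizer (LambdaDerived p) x ≤ K) :
    K ≤ MulAction.stabilizer (LambdaDerived p) x := by
  intro k hk
  by_contra hne
  refine hK (LambdaDerived_eq_top_of_germs (fun e => hne e.symm : x ≠ k • x) hx ?_)
  rw [← map_conj_germStabilizer]
  rintro _ ⟨g, hg, rfl⟩
  exact mul_mem (mul_mem hk (hx hg)) (inv_mem hk)

theorem exists_smul_eq_off {τ : ℤ_[p] → ℤ_[p]} (hτ : IsAffineEmbedding τ)
    {U : Set ℤ_[p]} (hU : IsOpen U) (hne : U.Nonempty) (hτU : ∀ z, τ z ∉ U) :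
    ∃ η : LambdaDerived p, ∀ u : LambdaDerived p, (∀ z ∈ U, u • z = z) →
      (AffineFamily.single hτ).spreadDerived u = η * u * η⁻¹ := by
  obtain ⟨η, hη, h⟩ := exists_LambdaDerived_eq_off hτ hU hne hτU
  exact ⟨⟨η, hη⟩, fun u hu => Subtype.ext (conj_eq_single_spread hτ h hu)⟩

theorem ConjInvariant.map_conj_inv_mem {S : Set (Subgroup (LambdaDerived p))}
    (hS : ConjInvariant S) {K : Subgroup (LambdaDerived p)} (hK : K ∈ S) (g : LambdaDerived p) :
    ∃ K' ∈ S, ∀ u, u ∈ K' ↔ g * u * g⁻¹ ∈ K :=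
  ⟨_, hS g⁻¹ K hK, fun u => by rw [mem_map_conj_iff, inv_inv]⟩

/-- Subgroups in a URS different from `{⊥}` contain a copy of the whole derived subgroup acting
on the image of some embedding. -/
theorem exists_embedding_spreadDerived_mem {S : Set (Subgroup (LambdaDerived p))} (hS : IsURS S)
    (hbot : S ≠ {⊥}) :
    ∃ H ∈ S, ∃ (f : ℤ_[p] → ℤ_[p]) (hf : IsAffineEmbedding f) (B : Set ℤ_[p]), IsOpen B ∧
      B.Nonempty ∧ (∀ z, f z ∉ B) ∧ ∀ u, (AffineFamily.single hf).spreadDerived u ∈ H := by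
  obtain ⟨⟨⟨H, hH⟩, hSc, hSi⟩, -⟩ := id hS
  have hbot' : ⊥ ∉ closure S := fun h => hbot (hS.eq_singleton_bot (by rwa [hSc.closure_eq] at h))
  rw [mem_closure_chabauty_iff] at hbot'
  push Not at hbot'
  obtain ⟨F, hF⟩ := hbot'
  -- A member of `S` that disagrees with `⊥` on `F` contains a non-trivial element of `F`.
  let J := {g : LambdaDerived p // g ∈ F ∧ g ≠ 1}
  have : Finite J := Finite.of_injective (fun g : J => (⟨g.1, g.2.1⟩ : F)) fun a b h =>
    Subtype.ext (congrArg (fun c : F => (c : LambdaDerived p)) h)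
  have hJ : ∀ K ∈ S, ∃ j : J, j.1 ∈ K := by
    intro K hK
    obtain ⟨g, hgF, hg⟩ := hF K hK
    rw [Subgroup.mem_bot] at hg
    have hgK : g ∈ K := by
      by_contra h
      rcases hg with hg | hg
      · exact h hg.1
      · exact h (hg.2 ▸ one_mem K)
    exact ⟨⟨g, hgF, fun h => by simp_all⟩, hgK⟩
  obtain ⟨τ, B, hB, hBne, hτ, hτB, hgB⟩ := exists_displaced_family (fun j : J => j.1) fun j => j.2.2
  have hloc : ∀ K ∈ S, ∃ j, ∀ u : LambdaDerived p, ∃ a ∈ K,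
      (∀ z, a • τ j z = τ j (u • z)) ∧ ∀ y ∈ B, a • y = y := by
    intro K hK
    refine exists_index_forall_exists_mem hτ hτB hgB K fun u => ?_
    obtain ⟨K', hK', h⟩ := hSi.map_conj_inv_mem hK u⁻¹
    obtain ⟨j, hj⟩ := hJ K' hK'
    exact ⟨j, by simpa using (h j.1).1 hj⟩
  obtain ⟨j, hj⟩ := hloc H hH
  have hf : IsAffineEmbedding (τ j) := ⟨τ.locallyAffineAt j, fun z w e =>
    congrArg Prod.snd (τ.injective (a₁ := (j, z)) (a₂ := (j, w)) e)⟩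
  refine ⟨H, hH, τ j, hf, B, hB, hBne, hτB j, ?_⟩
  set Φ := (AffineFamily.single hf).spreadDerived
  obtain ⟨η, hη⟩ := exists_smul_eq_off hf hB hBne (hτB j)
  -- Some `a ∈ H` acts as `u` on the image of `τ j`, so conjugation by `a` realises conjugation by
  -- `u` on copies supported there.
  have hN : (H.comap Φ).Normal := by
    refine ⟨fun n hn u => ?_⟩
    obtain ⟨a, ha, haτ, -⟩ := hj u
    have e : Φ (u * n * u⁻¹) = a * Φ n * a⁻¹ := by
      refine Subtype.ext (AffineFamily.spread_single_eq hf (fun z => ?_) fun y hy => ?_)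
      · change (a * Φ n * a⁻¹) • τ j z = τ j ((u * n * u⁻¹) • z)
        have h1 : a⁻¹ • τ j z = τ j (u⁻¹ • z) := by rw [inv_smul_eq_iff, haτ, smul_inv_smul]
        have h2 : ∀ w, Φ n • τ j w = τ j (n • w) := fun w =>
          (AffineFamily.single hf).spreadDerived_smul n () w
        rw [mul_smul, mul_smul, h1, h2, haτ, mul_smul, mul_smul]
      · change (a * Φ n * a⁻¹) • y = y
        have h1 : Φ n • a⁻¹ • y = a⁻¹ • y :=
          (AffineFamily.single hf).spreadDerived_smul_of_notMem n fun _ z e => hy (u • z) (by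
            rw [← haτ, show τ j z = a⁻¹ • y from e, smul_inv_smul])
        rw [mul_smul, mul_smul, h1, smul_inv_smul]
    rw [Subgroup.mem_comap, e]
    exact mul_mem (mul_mem ha hn) (inv_mem ha)
  -- The conjugate `K` of `H` by `η⁻¹` also belongs to `S`, so it contains some `a ≠ 1` trivial on
  -- `B`. Conjugating back by `η` turns `a` into its copy `Φ a`, which lies in `H`.
  have hNne : H.comap Φ ≠ ⊥ := by
    obtain ⟨K, hK, hKH⟩ := hSi.map_conj_inv_mem hH η
    obtain ⟨i, hi⟩ := hloc K hK
    have := LambdaDerived_infinite (p := p)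
    obtain ⟨u, hu⟩ := exists_ne (1 : LambdaDerived p)
    obtain ⟨a, ha, haτ, haB⟩ := hi u
    intro hbot
    have ha' : a ∈ H.comap Φ := by
      rw [Subgroup.mem_comap, hη a haB]
      exact (hKH a).1 ha
    rw [hbot, Subgroup.mem_bot] at ha'
    apply hu
    refine Subtype.ext (Homeomorph.ext fun z => ?_)
    have h := haτ z
    rw [ha', one_smul] at h
    exact (congrArg Prod.snd (τ.injective (a₁ := (i, z)) (a₂ := (i, u • z)) h)).symm
  intro u
  have : u ∈ H.comap Φ := by
    rw [normal_LambdaDerived_eq_top _ hNne]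
    exact Subgroup.mem_top u
  exact this

theorem IsURS.eq_range_germStabilizer {S : Set (Subgroup (LambdaDerived p))} (hS : IsURS S)
    (hbot : S ≠ {⊥}) (htop : S ≠ {⊤}) :
    S = Set.range fun x : ℤ_[p] => germStabilizer (LambdaDerived p) x := by
  obtain ⟨H, hH, f, hf, B, hB, ⟨y, hy⟩, hfB, hfH⟩ := exists_embedding_spreadDerived_mem hS hbot
  obtain ⟨⟨-, hSc, hSi⟩, -⟩ := id hS
  -- Conjugation by a suitable `η` sends the fixator of the shrunken set into the copy of the
  -- derived subgroup inside `H`. As the radius tends to 0, these fixators exhaust the germ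
  -- stabilizer of `y`.
  have hK : ∀ n : ℕ, ∃ K ∈ S, ∀ u : LambdaDerived p,
      (∀ z ∈ B ∩ Metric.ball y (1 / (n + 1)), u • z = z) → u ∈ K := by
    intro n
    obtain ⟨η, hη⟩ := exists_smul_eq_off hf (hB.inter Metric.isOpen_ball)
      ⟨y, hy, Metric.mem_ball_self (Nat.one_div_pos_of_nat (α := ℝ) (n := n))⟩
      fun z hz => hfB z hz.1
    obtain ⟨K, hK, hKH⟩ := hSi.map_conj_inv_mem hH η
    exact ⟨K, hK, fun u hu => (hKH u).2 (hη u hu ▸ hfH u)⟩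
  choose K hKS hK using hK
  obtain ⟨L, hLS, hL⟩ := exists_mem_of_eventually_mem hSc hKS
  have hyL : germStabilizer (LambdaDerived p) y ≤ L := by
    intro u hu
    apply hL
    obtain ⟨ε, hε, h⟩ := Metric.eventually_nhds_iff_ball.1 (mem_germStabilizer_iff.1 hu)
    filter_upwards [tendsto_one_div_add_atTop_nhds_zero_nat.eventually (gt_mem_nhds hε)] with n hn
    exact hK n u fun z hz => h z (Metric.ball_subset_ball hn.le hz.2)
  have hLy := le_stabilizer_of_germStabilizer_le
    (fun e => htop (hS.eq_singleton_top (e ▸ hLS))) hyL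
  refine hS.eq_of_subset (Set.range_nonempty _) isClosed_range_germStabilizer
    conjInvariant_range_germStabilizer ?_
  rintro _ ⟨z, rfl⟩
  exact germStabilizer_mem_of_le hSc hSi hLS hyL hLy z

end Uniqueness

theorem mainTheorem9 (p : ℕ) [Fact p.Prime] :
    MulAction.IsMinimal (LambdaDerived p) ℤ_[p] ∧
    IsStabilizerURS (LambdaDerived p) ℤ_[p]
      (Set.range fun x : ℤ_[p] => germStabilizer (LambdaDerived p) x) ∧
    ∀ S : Set (Subgroup (LambdaDerived p)),
      IsNontrivialURS S ↔ S = Set.range fun x : ℤ_[p] => germStabilizer (LambdaDerived p) x := by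
  have hne : ∀ T : Set (Subgroup (LambdaDerived p)),
      T ⊆ closure (Set.range fun x : ℤ_[p] => MulAction.stabilizer (LambdaDerived p) x) →
        T ≠ {⊥} ∧ T ≠ {⊤} := by
    refine fun T hT => ⟨?_, ?_⟩ <;> rintro rfl
    · exact bot_notMem_closure_stabilizers (hT rfl)
    · exact top_notMem_closure_stabilizers (hT rfl)
  refine ⟨LambdaDerived_isMinimal,
    ⟨⟨isURS_range_germStabilizer, range_germStabilizer_subset_closure⟩, fun T hT hTc =>
      hT.eq_range_germStabilizer (hne T hTc).1 (hne T hTc).2⟩, fun S =>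
    ⟨fun h => h.1.eq_range_germStabilizer h.2.1 h.2.2, ?_⟩⟩
  rintro rfl
  exact ⟨isURS_range_germStabilizer, hne _ range_germStabilizer_subset_closure⟩
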